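/- **Setting.** Let $k\in\mathbb N=\{0,1,2,\dots\}$ and let $\Lambda$ be a $k$-graph: a countable small category with a degree functor $d:\Lambda\to\mathbb N^k$ such that whenever $d(\lambda)=m+n$ there are unique $\mu,\nu\in\Lambda$ with $d(\mu)=m$, $d(\nu)=n$, $\lambda=\mu\nu$. Write $\Lambda^0$ for its vertices (objects), $r,s:\Lambda\to\Lambda^0$ for range and source, $\Lambda^n=d^{-1}(n)$, $v\Lambda^n=\{\lambda\in\Lambda^n: r(\lambda)=v\}$ and $v\Lambda^n w=\{\lambda\in v\Lambda^n : s(\lambda)=w\}$. Assume that $\Lambda$ is nonempty, finite (every $\Lambda^n$ is finite), strongly connected (for all $v,w\in\Lambda^0$ there is $\lambda\in\Lambda$ with $r(\lambda)=v$, $s(\lambda)=w$) and has no sources ($v\Lambda^n\neq\emptyset$ for all $v\in\Lambda^0$, $n\in\mathbb N^k$). *Path space and measure.* Let $\rho_i$ be the spectral radius of the matrix $A_i(v,w)=\#(v\Lambda^{e_i}w)$, where $e_i$ is the $i$-th standard basis vector of $\mathbb N^k$, and let $\rho(\Lambda)^n=\prod_i\rho_i^{n_i}$. There is a unique positive vector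 $x^\Lambda\in(0,\infty)^{\Lambda^0}$ with $\sum_v x^\Lambda_v=1$ and $A_ix^\Lambda=\rho_ix^\Lambda$ for all $i$. An infinite path is a degree-preserving functor $x:\Omega_k\to\Lambda$, where $\Omega_k$ has objects $\mathbb N^k$ and exactly one morphism $(m,n)$, of range $m$, source $n$ and degree $n-m$, for each $m\le n$; $\Lambda^\infty$ is the set of infinite paths, with the topology generated by the cylinder sets $[\lambda]=\{x: x(0,d(\lambda))=\lambda\}$; and $\sigma^p(x)(m,n)=x(m+p,n+p)$. There is a unique Borel measure $M$ on $\Lambda^\infty$ with $M([\lambda])=\rho(\Lambda)^{-d(\lambda)}x^\Lambda_{s(\lambda)}$ for all $\lambda\in\Lambda$. *Algebra and representation.* Let $C^*(\Lambda)$ be the universal C*-algebra generated by partial isometries $s_\lambda$ $(\lambda\in\Lambda)$ such that the $s_v$, $v\in\Lambda^0$, are mutually orthogonal projections; $s_\lambda s_\eta=s_{\lambda\eta}$ if $s(\lambda)=r(\eta)$; $s_\lambda^*s_\lambda=s_{s(\lambda)}$; and $\sum_{\lambda\in v\Lambda^n}s_\lambda s_\lambda^*=s_v$ for all $v\in\Lambda^0$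 and $n\in\mathbb N^k$. Let $\mathcal A_\Lambda$ be the linear span of $\{s_\lambda s_\eta^*:\lambda,\eta\in\Lambda\}$. There is a unique $*$-representation $\pi$ of $C^*(\Lambda)$ on $L^2(\Lambda^\infty,M)$ with $$\big(\pi(s_\lambda)\chi_{[\eta]}\big)(x)=\chi_{[\lambda]}(x)\,\rho(\Lambda)^{d(\lambda)/2}\,\chi_{[\eta]}(\sigma^{d(\lambda)}(x))\quad\text{for } M\text{-a.e. } x,\qquad \lambda,\eta\in\Lambda .$$ *Dirac operator.* Let $\mathcal R_{-1}\subset L^2(\Lambda^\infty,M)$ be the constant functions and, for $q\ge0$, let $\mathcal R_q$ be the span of the $\chi_{[\eta]}$ with $d(\eta)_i\le q$ for all $i$; let $\Xi_q$ be the orthogonal projection onto $\mathcal R_q$. Let $(\alpha_q)_{q\ge0}$ be an increasing (not necessarily strictly) sequence of positive reals with $\alpha_q\to\infty$, and let $D=\sum_{q\ge0}\alpha_q(\Xi_q-\Xi_{q-1})$, with domain the set of all $f\in L^2(\Lambda^\infty,M)$ for which the series $\sum_q\alpha_q(\Xi_q-\Xi_{q-1})f$ converges (unconditionally) in norm. **Theorem.**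 If there is a constant $C\ge0$ with $|\alpha_{q+1}-\alpha_q|\le C$ for all $q\ge0$, then for every $a\in\mathcal A_\Lambda$ the commutator $[D,\pi(a)]$ is bounded: $\pi(a)$ maps the domain of $D$ into itself and $D\pi(a)-\pi(a)D$ extends to a bounded operator on $L^2(\Lambda^\infty,M)$. Moreover $(\mathcal A_\Lambda,L^2(\Lambda^\infty,M),D)$, with the representation $\pi$, is a spectral triple for $C^*(\Lambda)$: $\mathcal A_\Lambda$ is a dense $*$-subalgebra of $C^*(\Lambda)$, $D$ is densely defined and self-adjoint, $(D^2+1)^{-1}$ is compact, and $[D,\pi(a)]$ is bounded for all $a\in\mathcal A_\Lambda$. (Faithfulness of $\pi$ is not part of this notion of spectral triple.) The existence and uniqueness of $x^\Lambda$, $M$ and $\pi$ are part of the assertion. -/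

import Mathlib

open scoped ENNReal NNReal InnerProductSpace
open MeasureTheory Filter Topology

universe u

noncomputable section

/-- A `k`-graph: a countable small category with a degree functor to `ℕ^k` that has the
factorization property. Objects (vertices) form the type `V`, morphisms (paths) form the type `P`;
`comp p q` is the composite `p q`, which is meaningful only if `s p = r q` (all laws are restricted
to that case). -/
structure KGraph (k : ℕ) where
  V : Type u
  P : Type u
  countable : Countable P
  r : P → V
  s : P → V
  id : V → P
  comp : P → P → P
  deg : P → Fin k → ℕ
  r_id : ∀ v, r (id v) = v
  s_id : ∀ v, s (id v) = v
  r_comp : ∀ p q, s p = r q → r (comp p q) = r p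
  s_comp : ∀ p q, s p = r q → s (comp p q) = s q
  id_comp : ∀ p, comp (id (r p)) p = p
  comp_id : ∀ p, comp p (id (s p)) = p
  assoc : ∀ p q t, s p = r q → s q = r t → comp (comp p q) t = comp p (comp q t)
  deg_id : ∀ v, deg (id v) = 0
  deg_comp : ∀ p q, s p = r q → deg (comp p q) = deg p + deg q
  factorization : ∀ (p : P) (m n : Fin k → ℕ), deg p = m + n →
    ∃! t : P × P, deg t.1 = m ∧ deg t.2 = n ∧ s t.1 = r t.2 ∧ comp t.1 t.2 = p

namespace KGraph

variable {k : ℕ}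

/-- `Λ` is finite: there are finitely many paths of each degree. -/
class IsFinite (Λ : KGraph.{u} k) : Prop where
  finite_deg : ∀ n : Fin k → ℕ, {p : Λ.P | Λ.deg p = n}.Finite

/-- `Λ` has no sources: `v Λ^n` is nonempty for every vertex `v` and every degree `n`. -/
def NoSources (Λ : KGraph.{u} k) : Prop :=
  ∀ (v : Λ.V) (n : Fin k → ℕ), ∃ p : Λ.P, Λ.r p = v ∧ Λ.deg p = n

/-- `Λ` is strongly connected: `v Λ w` is nonempty for all vertices `v`, `w`. -/
def StronglyConnected (Λ : KGraph.{u} k) : Prop :=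
  ∀ v w : Λ.V, ∃ p : Λ.P, Λ.r p = v ∧ Λ.s p = w

/-! ### Infinite paths -/

/-- An infinite path: a degree-preserving functor from `Ω_k` to `Λ`, where `Ω_k` has object set
`ℕ^k` and one morphism `(m, n)` of range `m`, source `n` and degree `n - m` for each `m ≤ n`. -/
structure InfPath (Λ : KGraph.{u} k) where
  obj : (Fin k → ℕ) → Λ.V
  map : ∀ m n : Fin k → ℕ, m ≤ n → Λ.P
  r_map : ∀ m n h, Λ.r (map m n h) = obj m
  s_map : ∀ m n h, Λ.s (map m n h) = obj n
  map_id : ∀ m, map m m le_rfl = Λ.id (obj m)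
  map_comp : ∀ m n l (h : m ≤ n) (h' : n ≤ l),
    map m l (h.trans h') = Λ.comp (map m n h) (map n l h')
  deg_map : ∀ m n h, Λ.deg (map m n h) = n - m

variable (Λ : KGraph.{u} k)

/-- The shift map `σ^p` on infinite paths: `σ^p(x)(m, n) = x(m + p, n + p)`. -/
def shift (p : Fin k → ℕ) (x : Λ.InfPath) : Λ.InfPath where
  obj m := x.obj (m + p)
  map m n h := x.map (m + p) (n + p) (add_le_add_left h p)
  r_map _ _ _ := x.r_map _ _ _
  s_map _ _ _ := x.s_map _ _ _
  map_id _ := x.map_id _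
  map_comp _ _ _ _ _ := x.map_comp _ _ _ _ _
  deg_map m n h := by
    rw [x.deg_map]
    funext i
    simp only [Pi.sub_apply, Pi.add_apply]
    omega

/-- The cylinder set `[p] = {x | x(0, d(p)) = p}`. -/
def cylinder (p : Λ.P) : Set Λ.InfPath :=
  {x | x.map 0 (Λ.deg p) zero_le = p}

instance : TopologicalSpace Λ.InfPath :=
  TopologicalSpace.generateFrom (Set.range Λ.cylinder)

instance : MeasurableSpace Λ.InfPath := borel _

instance : BorelSpace Λ.InfPath := ⟨rfl⟩

/-! ### Perron-Frobenius data and the measure on the infinite path space -/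

section Finite

variable [Λ.IsFinite]

instance : Finite Λ.V := by
  have h : Set.Finite {p : Λ.P | Λ.deg p = 0} := IsFinite.finite_deg 0
  have := h.to_subtype
  refine Finite.of_injective (fun v => (⟨Λ.id v, Λ.deg_id v⟩ : {p : Λ.P | Λ.deg p = 0})) ?_
  intro v w hvw
  have h2 : Λ.id v = Λ.id w := congrArg Subtype.val hvw
  rw [← Λ.r_id v, h2, Λ.r_id]

instance : Fintype Λ.V := Fintype.ofFinite _

instance : DecidableEq Λ.V := Classical.decEq _

/-- The `i`-th adjacency matrix, `A_i(v, w) = #(v Λ^{e_i} w)`. -/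
def adj (i : Fin k) : Matrix Λ.V Λ.V ℕ :=
  fun v w => Set.ncard {p : Λ.P | Λ.r p = v ∧ Λ.s p = w ∧ Λ.deg p = Pi.single i 1}

/-- The spectral radius `ρ_i` of the `i`-th adjacency matrix. -/
def rho (i : Fin k) : ℝ :=
  (spectralRadius ℂ ((Λ.adj i).map (fun a : ℕ => (a : ℂ)))).toReal

/-- `ρ(Λ)^n = ρ_1^{n_1} ⋯ ρ_k^{n_k}`. -/
def rhoPow (n : Fin k → ℕ) : ℝ := ∏ i, Λ.rho i ^ n i

/-- `x` is a positive vector with entries summing to one and `A_i x = ρ_i x` for all `i`. -/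
def IsPerronFrobenius (x : Λ.V → ℝ) : Prop :=
  (∀ v, 0 < x v) ∧ ∑ v, x v = 1 ∧
    ∀ i, ((Λ.adj i).map (fun a : ℕ => (a : ℝ))).mulVec x = Λ.rho i • x

open Classical in
/-- The Perron-Frobenius eigenvector `x^Λ` (the zero vector if there is none). -/
def pfVector : Λ.V → ℝ :=
  if h : ∃ x, Λ.IsPerronFrobenius x then h.choose else 0

/-- `μ` is a Borel measure with `μ[p] = ρ(Λ)^{-d(p)} x^Λ_{s(p)}` for all paths `p`. -/
def IsPathMeasure (μ : Measure Λ.InfPath) : Prop :=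
  ∀ p : Λ.P, μ (Λ.cylinder p) =
    ENNReal.ofReal ((Λ.rhoPow (Λ.deg p))⁻¹ * Λ.pfVector (Λ.s p))

open Classical in
/-- The measure `M` on the infinite path space (zero if there is none). -/
def pathMeasure : Measure Λ.InfPath :=
  if h : ∃ μ, Λ.IsPathMeasure μ then h.choose else 0

/-- The Hilbert space `L²(Λ^∞, M)`. -/
abbrev L2 : Type u := Lp ℂ 2 Λ.pathMeasure

/-- The characteristic function of the cylinder set `[p]`. -/
def chi (p : Λ.P) : Λ.InfPath → ℂ := (Λ.cylinder p).indicator (fun _ => 1)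

/-! ### The Dirac operator -/

/-- `R_{-1}`: the constant functions. -/
def constSpan : Submodule ℂ Λ.L2 :=
  Submodule.span ℂ {f : Λ.L2 | f =ᵐ[Λ.pathMeasure] fun _ => 1}

/-- `R_n` for `n ≥ 0`: the span of the characteristic functions `χ_[p]` with
`max_i d(p)_i ≤ n`. -/
def cylSpan (n : ℕ) : Submodule ℂ Λ.L2 :=
  Submodule.span ℂ {f : Λ.L2 | ∃ p : Λ.P, (∀ i, Λ.deg p i ≤ n) ∧ f =ᵐ[Λ.pathMeasure] Λ.chi p}

/-- `R_{n-1}` for `n ≥ 0`. -/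
def cylSpanPred : ℕ → Submodule ℂ Λ.L2
  | 0 => Λ.constSpan
  | n + 1 => Λ.cylSpan n

theorem subsingleton_ae_class (g : Λ.InfPath → ℂ) :
    {f : Λ.L2 | f =ᵐ[Λ.pathMeasure] g}.Subsingleton := by
  intro f hf f' hf'
  have h1 : f =ᵐ[Λ.pathMeasure] g := hf
  have h2 : f' =ᵐ[Λ.pathMeasure] g := hf'
  exact Lp.ext (h1.trans h2.symm)

instance : FiniteDimensional ℂ Λ.constSpan :=
  FiniteDimensional.span_of_finite ℂ (Λ.subsingleton_ae_class _).finite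

instance (n : ℕ) : FiniteDimensional ℂ (Λ.cylSpan n) := by
  refine FiniteDimensional.span_of_finite ℂ ?_
  have h1 : {p : Λ.P | ∀ i, Λ.deg p i ≤ n}.Finite := by
    refine ((Set.finite_Iic (fun _ : Fin k => n)).biUnion
      (fun m _ => IsFinite.finite_deg (Λ := Λ) m)).subset ?_
    intro p hp
    simp only [Set.mem_iUnion]
    exact ⟨Λ.deg p, hp, rfl⟩
  refine (h1.biUnion (fun p _ => (Λ.subsingleton_ae_class (Λ.chi p)).finite)).subset ?_
  rintro f ⟨p, hp, hf⟩
  simp only [Set.mem_iUnion]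
  exact ⟨p, hp, hf⟩

instance : ∀ n : ℕ, FiniteDimensional ℂ (Λ.cylSpanPred n)
  | 0 => inferInstanceAs (FiniteDimensional ℂ Λ.constSpan)
  | n + 1 => inferInstanceAs (FiniteDimensional ℂ (Λ.cylSpan n))

/-- `Ξ_q - Ξ_{q-1}`, where `Ξ_q` is the orthogonal projection onto `R_q`. -/
def xiDiff (q : ℕ) : Λ.L2 →L[ℂ] Λ.L2 :=
  (Λ.cylSpan q).starProjection - (Λ.cylSpanPred q).starProjection

/-- The domain of the Dirac operator: the vectors `f` at which the series
`∑_q α_q (Ξ_q - Ξ_{q-1}) f` converges in `L²(Λ^∞, M)`. -/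
def diracDomain (α : ℕ → ℝ) : Submodule ℂ Λ.L2 where
  carrier := {f | Summable fun q => (α q : ℂ) • Λ.xiDiff q f}
  zero_mem' := by
    simp only [Set.mem_ofPred_eq, map_zero, smul_zero]
    exact summable_zero
  add_mem' := by
    intro f g hf hg
    simp only [Set.mem_ofPred_eq, map_add, smul_add]
    exact Summable.add hf hg
  smul_mem' := by
    intro c f hf
    simp only [Set.mem_ofPred_eq, map_smul, smul_comm _ c]
    exact Summable.const_smul c hf

/-- The diagonal operator `D = ∑_q α_q (Ξ_q - Ξ_{q-1})`, with its maximal domain. -/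
def dirac (α : ℕ → ℝ) : Λ.L2 →ₗ.[ℂ] Λ.L2 where
  domain := Λ.diracDomain α
  toFun :=
    { toFun := fun f => ∑' q, (α q : ℂ) • Λ.xiDiff q (f : Λ.L2)
      map_add' := by
        intro f g
        rw [← Summable.tsum_add f.2 g.2]
        simp only [Submodule.coe_add, map_add, smul_add]
      map_smul' := by
        intro c f
        rw [RingHom.id_apply, ← Summable.tsum_const_smul c f.2]
        simp only [Submodule.coe_smul, map_smul, smul_comm _ c] }

/-! ### The C*-algebra of `Λ` -/

/-- The finite set `v Λ^n`. -/
def pathsTo (v : Λ.V) (n : Fin k → ℕ) : Finset Λ.P :=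
  ((IsFinite.finite_deg (Λ := Λ) n).subset
    (fun _ h => h.2 : {p : Λ.P | Λ.r p = v ∧ Λ.deg p = n} ⊆ {p | Λ.deg p = n})).toFinset

/-- A Cuntz-Krieger `Λ`-family in a C*-algebra: partial isometries with (CK1)-(CK4). -/
structure CKFamily (B : Type*) [NonUnitalCStarAlgebra B] where
  t : Λ.P → B
  partial_isometry : ∀ p, t p * star (t p) * t p = t p
  proj : ∀ v, IsStarProjection (t (Λ.id v))
  orthogonal : ∀ v w, v ≠ w → t (Λ.id v) * t (Λ.id w) = 0
  mul : ∀ p q, Λ.s p = Λ.r q → t p * t q = t (Λ.comp p q)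
  star_mul_self : ∀ p, star (t p) * t p = t (Λ.id (Λ.s p))
  sum_mul_star : ∀ (v : Λ.V) (n : Fin k → ℕ),
    ∑ p ∈ Λ.pathsTo v n, t p * star (t p) = t (Λ.id v)

theorem CKFamily.norm_le_one {Λ : KGraph.{u} k} [Λ.IsFinite] {B : Type*} [NonUnitalCStarAlgebra B]
    (T : Λ.CKFamily B) (p : Λ.P) : ‖T.t p‖ ≤ 1 := by
  have h1 : ‖T.t p‖ * ‖T.t p‖ ≤ 1 := by
    rw [← CStarRing.norm_star_mul_self, T.star_mul_self]
    exact (T.proj _).norm_le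
  nlinarith [norm_nonneg (T.t p)]

/-- A C*-algebra together with a Cuntz-Krieger `Λ`-family in it. -/
structure CKPair where
  B : Type u
  [alg : NonUnitalCStarAlgebra B]
  fam : Λ.CKFamily B

instance (T : Λ.CKPair) : NonUnitalCStarAlgebra T.B := T.alg

/-- The family of all `t_p`, where `t` runs through all Cuntz-Krieger `Λ`-families in C*-algebras,
as an element of the bounded product of these C*-algebras. -/
def prodGen (p : Λ.P) : lp (fun T : Λ.CKPair => T.B) ∞ :=
  ⟨fun T => T.fam.t p, memℓp_infty ⟨1, by
    rintro _ ⟨T, rfl⟩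
    exact T.fam.norm_le_one p⟩⟩

/-- The universal C*-algebra `C*(Λ)` generated by a Cuntz-Krieger `Λ`-family: the C*-subalgebra
that the elements `prodGen p` generate in the bounded product of all C*-algebras that carry a
Cuntz-Krieger `Λ`-family. -/
def cstarSubalgebra : NonUnitalStarSubalgebra ℂ (lp (fun T : Λ.CKPair => T.B) ∞) :=
  (NonUnitalStarAlgebra.adjoin ℂ (Set.range Λ.prodGen)).topologicalClosure

instance : IsClosed (Λ.cstarSubalgebra : Set (lp (fun T : Λ.CKPair => T.B) ∞)) :=
  NonUnitalStarSubalgebra.isClosed_topologicalClosure _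

/-- `C*(Λ)` as a type; it is a C*-algebra. -/
abbrev CStar : Type (u + 1) := Λ.cstarSubalgebra

instance : NonUnitalCStarAlgebra Λ.CStar :=
  NonUnitalStarSubalgebra.nonUnitalCStarAlgebra Λ.cstarSubalgebra

/-- The canonical generator `s_p` of `C*(Λ)`. -/
def gen (p : Λ.P) : Λ.CStar :=
  ⟨Λ.prodGen p, NonUnitalStarSubalgebra.le_topologicalClosure _
    (NonUnitalStarAlgebra.subset_adjoin ℂ _ ⟨p, rfl⟩)⟩

/-- The generators form a Cuntz-Krieger `Λ`-family in `C*(Λ)`. -/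
def genFamily : Λ.CKFamily Λ.CStar where
  t := Λ.gen
  partial_isometry p := Subtype.ext <| by ext T; exact T.fam.partial_isometry p
  proj v := ⟨Subtype.ext <| by ext T; exact (T.fam.proj v).1,
    Subtype.ext <| by ext T; exact (T.fam.proj v).2⟩
  orthogonal v w h := Subtype.ext <| by ext T; exact T.fam.orthogonal v w h
  mul p q h := Subtype.ext <| by ext T; exact T.fam.mul p q h
  star_mul_self p := Subtype.ext <| by ext T; exact T.fam.star_mul_self p
  sum_mul_star v n := Subtype.ext <| by
    ext T
    refine Eq.trans ?_ (T.fam.sum_mul_star v n)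
    let φ : Λ.CStar →+ T.B :=
      ⟨⟨fun a => (a : lp (fun T : Λ.CKPair => T.B) ∞) T, rfl⟩, fun _ _ => rfl⟩
    exact map_sum φ _ _

/-- The universal property: every Cuntz-Krieger `Λ`-family is the image of `gen` under a
*-homomorphism. -/
theorem exists_lift (B : Type u) [NonUnitalCStarAlgebra B] (T : Λ.CKFamily B) :
    ∃ φ : Λ.CStar →⋆ₙₐ[ℂ] B, ∀ p, φ (Λ.gen p) = T.t p :=
  ⟨{ toFun := fun a => (a : lp (fun T : Λ.CKPair => T.B) ∞) ⟨B, T⟩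
     map_smul' := fun _ _ => rfl
     map_zero' := rfl
     map_add' := fun _ _ => rfl
     map_mul' := fun _ _ => rfl
     map_star' := fun _ => rfl }, fun _ => rfl⟩

/-- `𝒜_Λ`: the linear span of the elements `s_p s_q^*`. -/
def smoothAlg : Submodule ℂ Λ.CStar :=
  Submodule.span ℂ {a | ∃ p q : Λ.P, a = Λ.gen p * star (Λ.gen q)}

/-- `π` is the representation of `C*(Λ)` on `L²(Λ^∞, M)` that is given on characteristic functions
by `(π(s_p) χ_[q])(x) = χ_[p](x) ρ(Λ)^{d(p)/2} χ_[q](σ^{d(p)}(x))`. -/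
def IsPathRep (π : Λ.CStar →⋆ₙₐ[ℂ] (Λ.L2 →L[ℂ] Λ.L2)) : Prop :=
  ∀ (p q : Λ.P) (f : Λ.L2), f =ᵐ[Λ.pathMeasure] Λ.chi q →
    π (Λ.gen p) f =ᵐ[Λ.pathMeasure]
      fun x => Λ.chi p x * (Real.sqrt (Λ.rhoPow (Λ.deg p)) : ℂ) * Λ.chi q (Λ.shift (Λ.deg p) x)

end Finite

end KGraph

/-! ### Spectral triples -/

section SpectralTriple

variable {A H : Type*} [NonUnitalCStarAlgebra A] [NormedAddCommGroup H] [InnerProductSpace ℂ H]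
  [CompleteSpace H]

/-- The commutator `[D, T]` is bounded: `T` preserves the domain of `D`, and `D T - T D` is on that
domain the restriction of a bounded operator. -/
def HasBoundedCommutator (D : H →ₗ.[ℂ] H) (T : H →L[ℂ] H) : Prop :=
  ∃ S : H →L[ℂ] H, ∀ f : D.domain, ∃ h : T f ∈ D.domain, S f = D ⟨T f, h⟩ - T (D f)

/-- `(D² + 1)⁻¹` is a (bounded, everywhere defined) compact operator. -/
def HasCompactResolvent (D : H →ₗ.[ℂ] H) : Prop :=
  ∃ R : H →L[ℂ] H, IsCompactOperator R ∧
    ∀ f g : H, R g = f ↔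
      ∃ (h : f ∈ D.domain) (h' : D ⟨f, h⟩ ∈ D.domain), D ⟨D ⟨f, h⟩, h'⟩ + f = g

/-- `(𝒜, H, D)` is a spectral triple for the C*-algebra `A`, with `𝒜` represented on `H` by `π`. -/
structure IsSpectralTriple (𝒜 : Submodule ℂ A) (π : A →⋆ₙₐ[ℂ] (H →L[ℂ] H))
    (D : H →ₗ.[ℂ] H) : Prop where
  mul_mem : ∀ a ∈ 𝒜, ∀ b ∈ 𝒜, a * b ∈ 𝒜
  star_mem : ∀ a ∈ 𝒜, star a ∈ 𝒜
  dense : Dense (𝒜 : Set A)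
  dense_domain : Dense (D.domain : Set H)
  self_adjoint : IsSelfAdjoint D
  compact_resolvent : HasCompactResolvent D
  bounded_commutator : ∀ a ∈ 𝒜, HasBoundedCommutator D (π a)

end SpectralTriple

end

/-! The operator D is diagonal for the filtration R_{-1} ⊂ R_0 ⊂ R_1 ⊂ … of L²(Λ^∞, M) by
finite-dimensional subspaces with dense union. Self-adjointness and the compact resolvent hold for
every diagonal operator with its maximal domain, real eigenvalues tending to infinity and
finite-rank projections (`IsDiagonalOperator.isSelfAdjoint`,
`IsDiagonalOperator.hasCompactResolvent`).

The commutator is bounded because each π(a) with a ∈ 𝒜_Λ is a banded block matrix for this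
filtration (`exists_isBanded`). Indeed π(s_λ) sends χ_[η] to a multiple of χ_[λη] or to 0, and its
adjoint strips λ off χ_[η] once χ_[η] has been expanded over longer paths; both raise the level by
an amount that depends only on d(λ). The (p, q) block of [D, T] is the block of T times the
difference of two eigenvalues. If T has band width c, then this block vanishes for |p - q| > c, and
otherwise the difference is at most a constant times c. As each index lies in at most 2c + 1 bands,
such a matrix is bounded (`IsBanded.hasBoundedCommutator`).

The objects in the statement have to be constructed as well. No single A_i need be irreducible, but
strong connectivity makes a suitable sum of products of them strictly positive. It has a
one-dimensional Perron-Frobenius eigenspace, which the commuting A_i preserve; this gives x^Λ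
(`existsUnique_perronFrobenius`). The eigenvector equation says that the prescribed values on
cylinder sets are additive (`sum_weight`), and M is the image of Lebesgue measure on [0, 1] under a
map built from successive subdivisions (`exists_isPathMeasure`). The shift by d(λ) scales M on [λ]
by ρ(Λ)^{-d(λ)}, which yields the Cuntz-Krieger relations (`pathFamily`) and hence π. Finally, 𝒜_Λ
is a *-algebra because s_p^* s_q expands over paths of degree d(p) ∨ d(q)
(`CKFamily.star_t_mul_t_mem_span`). -/

noncomputable section

namespace KGraph

variable {k : ℕ}

/-! ### Factorization of paths, infinite paths and cylinder sets -/

section Combinatorics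

variable {Λ : KGraph.{u} k}

/-- Degrees cancel in ℕ^k, so q and q' have the same degree too, and unique factorization applies to
the common composite. -/
theorem comp_inj {p q p' q' : Λ.P} (hpq : Λ.s p = Λ.r q) (hpq' : Λ.s p' = Λ.r q')
    (hd : Λ.deg p = Λ.deg p') (h : Λ.comp p q = Λ.comp p' q') : p = p' ∧ q = q' := by
  have hq : Λ.deg q = Λ.deg q' := by
    have h1 := Λ.deg_comp p q hpq
    rw [h, Λ.deg_comp p' q' hpq', hd] at h1
    exact (add_left_cancel h1).symm
  obtain ⟨t, -, ht⟩ := Λ.factorization (Λ.comp p q) (Λ.deg p) (Λ.deg q) (Λ.deg_comp p q hpq)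
  have h1 := ht (p, q) ⟨rfl, rfl, hpq, rfl⟩
  have h2 := ht (p', q') ⟨hd.symm, hq.symm, hpq', h.symm⟩
  simpa using h1.trans h2.symm

theorem exists_factorization (p : Λ.P) {m : Fin k → ℕ} (h : m ≤ Λ.deg p) :
    ∃ t : Λ.P × Λ.P, Λ.deg t.1 = m ∧ Λ.s t.1 = Λ.r t.2 ∧ Λ.comp t.1 t.2 = p := by
  obtain ⟨t, ⟨h1, -, h2, h3⟩, -⟩ :=
    Λ.factorization p m (Λ.deg p - m) (add_tsub_cancel_of_le h).symm
  exact ⟨t, h1, h2, h3⟩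

open Classical in
/-- The initial segment of degree `m` of a path `p` (junk unless `m ≤ d(p)`). -/
def head (p : Λ.P) (m : Fin k → ℕ) : Λ.P :=
  if h : m ≤ Λ.deg p then (exists_factorization p h).choose.1 else p

open Classical in
/-- What remains of `p` after its initial segment of degree `m` (junk unless `m ≤ d(p)`). -/
def tail (p : Λ.P) (m : Fin k → ℕ) : Λ.P :=
  if h : m ≤ Λ.deg p then (exists_factorization p h).choose.2 else p

theorem deg_head {p : Λ.P} {m : Fin k → ℕ} (h : m ≤ Λ.deg p) : Λ.deg (head p m) = m := by
  rw [head, dif_pos h]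
  exact (exists_factorization p h).choose_spec.1

theorem s_head {p : Λ.P} {m : Fin k → ℕ} (h : m ≤ Λ.deg p) :
    Λ.s (head p m) = Λ.r (tail p m) := by
  rw [head, tail, dif_pos h, dif_pos h]
  exact (exists_factorization p h).choose_spec.2.1

theorem head_comp_tail {p : Λ.P} {m : Fin k → ℕ} (h : m ≤ Λ.deg p) :
    Λ.comp (head p m) (tail p m) = p := by
  rw [head, tail, dif_pos h, dif_pos h]
  exact (exists_factorization p h).choose_spec.2.2

theorem deg_add_deg_tail {p : Λ.P} {m : Fin k → ℕ} (h : m ≤ Λ.deg p) :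
    m + Λ.deg (tail p m) = Λ.deg p := by
  conv_rhs => rw [← head_comp_tail h, Λ.deg_comp _ _ (s_head h), deg_head h]

theorem deg_tail {p : Λ.P} {m : Fin k → ℕ} (h : m ≤ Λ.deg p) :
    Λ.deg (tail p m) = Λ.deg p - m := by
  rw [← deg_add_deg_tail h, add_tsub_cancel_left]

theorem s_tail {p : Λ.P} {m : Fin k → ℕ} (h : m ≤ Λ.deg p) : Λ.s (tail p m) = Λ.s p := by
  conv_rhs => rw [← head_comp_tail h, Λ.s_comp _ _ (s_head h)]

theorem r_head {p : Λ.P} {m : Fin k → ℕ} (h : m ≤ Λ.deg p) : Λ.r (head p m) = Λ.r p := by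
  conv_rhs => rw [← head_comp_tail h, Λ.r_comp _ _ (s_head h)]

theorem deg_le_deg_comp {p q : Λ.P} (h : Λ.s p = Λ.r q) : Λ.deg p ≤ Λ.deg (Λ.comp p q) := by
  rw [Λ.deg_comp p q h]
  exact le_self_add

theorem head_comp {p q : Λ.P} (h : Λ.s p = Λ.r q) : head (Λ.comp p q) (Λ.deg p) = p :=
  (comp_inj (s_head (deg_le_deg_comp h)) h (deg_head (deg_le_deg_comp h))
    (head_comp_tail (deg_le_deg_comp h))).1

theorem tail_comp {p q : Λ.P} (h : Λ.s p = Λ.r q) : tail (Λ.comp p q) (Λ.deg p) = q :=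
  (comp_inj (s_head (deg_le_deg_comp h)) h (deg_head (deg_le_deg_comp h))
    (head_comp_tail (deg_le_deg_comp h))).2

theorem head_self (p : Λ.P) : head p (Λ.deg p) = p := by
  have h := head_comp (Λ.r_id (Λ.s p)).symm
  rwa [Λ.comp_id] at h

theorem tail_self (p : Λ.P) : tail p (Λ.deg p) = Λ.id (Λ.s p) := by
  have h := tail_comp (Λ.r_id (Λ.s p)).symm
  rwa [Λ.comp_id] at h

theorem tail_zero (p : Λ.P) : tail p 0 = p := by
  have h := tail_comp (Λ.s_id (Λ.r p))
  rwa [Λ.id_comp, Λ.deg_id] at h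

theorem head_zero (p : Λ.P) : head p 0 = Λ.id (Λ.r p) := by
  have h := head_comp (Λ.s_id (Λ.r p))
  rwa [Λ.id_comp, Λ.deg_id] at h

/-- Two segmentations of a path at `m ≤ n` are compatible. -/
theorem head_head_tail {p : Λ.P} {m n : Fin k → ℕ} (hmn : m ≤ n) (hn : n ≤ Λ.deg p) :
    head (head p n) m = head p m ∧
      Λ.comp (tail (head p n) m) (tail p n) = tail p m := by
  have hm : m ≤ Λ.deg (head p n) := by rwa [deg_head hn]
  have e1 : Λ.s (tail (head p n) m) = Λ.r (tail p n) := by rw [s_tail hm, s_head hn]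
  refine comp_inj ?_ (s_head (hmn.trans hn)) ?_ ?_
  · rw [Λ.r_comp _ _ e1, s_head hm]
  · rw [deg_head hm, deg_head (hmn.trans hn)]
  · rw [← Λ.assoc _ _ _ (s_head hm) e1, head_comp_tail hm, head_comp_tail hn,
      head_comp_tail (hmn.trans hn)]

theorem head_head {p : Λ.P} {m n : Fin k → ℕ} (hmn : m ≤ n) (hn : n ≤ Λ.deg p) :
    head (head p n) m = head p m :=
  (head_head_tail hmn hn).1

theorem eq_id_of_deg_eq_zero {p : Λ.P} (h : Λ.deg p = 0) : p = Λ.id (Λ.r p) := by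
  rw [← head_zero, ← h, head_self]

namespace InfPath

/-- The initial segment `x(0, n)` of an infinite path. -/
def pre (x : Λ.InfPath) (n : Fin k → ℕ) : Λ.P := x.map 0 n zero_le

theorem deg_pre (x : Λ.InfPath) (n : Fin k → ℕ) : Λ.deg (x.pre n) = n := by
  rw [pre, x.deg_map]
  exact tsub_zero n

theorem s_pre (x : Λ.InfPath) (n : Fin k → ℕ) : Λ.s (x.pre n) = x.obj n := x.s_map _ _ _

theorem r_pre (x : Λ.InfPath) (n : Fin k → ℕ) : Λ.r (x.pre n) = x.obj 0 := x.r_map _ _ _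

theorem head_pre (x : Λ.InfPath) {m n : Fin k → ℕ} (h : m ≤ n) : head (x.pre n) m = x.pre m := by
  have h1 : x.pre n = Λ.comp (x.pre m) (x.map m n h) := x.map_comp 0 m n zero_le h
  have h2 : Λ.s (x.pre m) = Λ.r (x.map m n h) := by rw [x.s_pre, x.r_map]
  have h3 := head_comp h2
  rwa [← h1, x.deg_pre] at h3

theorem map_congr (x : Λ.InfPath) {m m' n n' : Fin k → ℕ} (hm : m = m') (hn : n = n')
    (h : m ≤ n) (h' : m' ≤ n') : x.map m n h = x.map m' n' h' := by
  subst hm hn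
  rfl

theorem s_pre_eq_r_pre_shift (x : Λ.InfPath) (m n : Fin k → ℕ) :
    Λ.s (x.pre m) = Λ.r ((Λ.shift m x).pre n) := by
  rw [s_pre, r_pre]
  change x.obj m = x.obj (0 + m)
  rw [zero_add]

theorem pre_add (x : Λ.InfPath) (m n : Fin k → ℕ) :
    x.pre (m + n) = Λ.comp (x.pre m) ((Λ.shift m x).pre n) := by
  have h1 := x.map_comp 0 m (m + n) zero_le le_self_add
  rw [pre, h1]
  congr 1
  exact x.map_congr (zero_add m).symm (add_comm m n) _ _

/-- The infinite path with prescribed coherent initial segments. -/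
def ofPre (F : (Fin k → ℕ) → Λ.P) (hd : ∀ n, Λ.deg (F n) = n)
    (hF : ∀ m n, m ≤ n → head (F n) m = F m) : Λ.InfPath where
  obj n := Λ.s (F n)
  map m n _ := tail (F n) m
  r_map m n h := by rw [← s_head (h.trans (hd n).ge), hF m n h]
  s_map m n h := s_tail (h.trans (hd n).ge)
  map_id m := by
    have h := tail_self (F m)
    rwa [hd] at h
  map_comp m n l h h' := by
    have := (head_head_tail (p := F l) h (h'.trans (hd l).ge)).2
    rw [hF n l h'] at this
    exact this.symm
  deg_map m n h := by rw [deg_tail (h.trans (hd n).ge), hd]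

theorem pre_ofPre (F : (Fin k → ℕ) → Λ.P) (hd : ∀ n, Λ.deg (F n) = n)
    (hF : ∀ m n, m ≤ n → head (F n) m = F m) (n : Fin k → ℕ) : (ofPre F hd hF).pre n = F n :=
  tail_zero _

end InfPath

/-- The degree `(n, …, n)`. -/
def diag (k n : ℕ) : Fin k → ℕ := fun _ => n

theorem diag_mono {m n : ℕ} (h : m ≤ n) : diag k m ≤ diag k n := fun _ => h

theorem le_diag_sum (n : Fin k → ℕ) : n ≤ diag k (∑ i, n i) := fun i =>
  Finset.single_le_sum (f := n) (fun _ _ => Nat.zero_le _) (Finset.mem_univ i)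

theorem sum_mono {m n : Fin k → ℕ} (h : m ≤ n) : ∑ i, m i ≤ ∑ i, n i :=
  Finset.sum_le_sum fun i _ => h i

/-- A nested sequence of paths of degrees `(n, …, n)` defines an infinite path. -/
theorem exists_infPath (f : ℕ → Λ.P) (hd : ∀ n, Λ.deg (f n) = diag k n)
    (hf : ∀ n, head (f (n + 1)) (diag k n) = f n) :
    ∃ x : Λ.InfPath, ∀ n, x.pre (diag k n) = f n := by
  have hle : ∀ m n, m ≤ n → head (f n) (diag k m) = f m := by
    intro m n h
    induction n, h using Nat.le_induction with
    | base => rw [← hd m, head_self]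
    | succ n h ih =>
      rw [← ih, ← hf n, head_head (diag_mono h)]
      rw [hd]
      exact diag_mono n.le_succ
  have key : ∀ m a b, m ≤ diag k a → a ≤ b → head (f b) m = head (f a) m := by
    intro m a b h1 h2
    rw [← hle a b h2, head_head h1]
    rw [hd]
    exact diag_mono h2
  -- A degree n lies below (N, …, N) with N = ∑ n_i, so x(0, n) can be read off from f N; by `key`
  -- any larger index gives the same segment.
  refine ⟨InfPath.ofPre (fun n => head (f (∑ i, n i)) n) ?_ ?_, ?_⟩
  · intro n
    apply deg_head
    rw [hd]
    exact le_diag_sum n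
  · intro m n h
    rw [head_head h (by rw [hd]; exact le_diag_sum n), key m _ _ (le_diag_sum m) (sum_mono h)]
  · intro n
    -- For k = 0 the sum ∑ᵢ n is 0 and need not dominate n, so both indices are compared with their
    -- maximum.
    rw [InfPath.pre_ofPre, ← key (diag k n) _ (max n (∑ i, diag k n i)) (le_diag_sum _)
      (le_max_right _ _), hle _ _ (le_max_left _ _)]

theorem mem_cylinder {p : Λ.P} {x : Λ.InfPath} : x ∈ Λ.cylinder p ↔ x.pre (Λ.deg p) = p := Iff.rfl

theorem mem_cylinder_of_pre {p : Λ.P} {x : Λ.InfPath} {n : Fin k → ℕ} (h : x.pre n = p) :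
    x ∈ Λ.cylinder p := by
  rw [mem_cylinder, ← h, x.deg_pre]

theorem mem_cylinder_iff {p : Λ.P} {n : Fin k → ℕ} (h : Λ.deg p = n) {x : Λ.InfPath} :
    x ∈ Λ.cylinder p ↔ x.pre n = p := by
  rw [mem_cylinder, h]

theorem mem_cylinder_comp {p q : Λ.P} (h : Λ.s p = Λ.r q) {x : Λ.InfPath} :
    x ∈ Λ.cylinder (Λ.comp p q) ↔ x ∈ Λ.cylinder p ∧ Λ.shift (Λ.deg p) x ∈ Λ.cylinder q := by
  rw [mem_cylinder, mem_cylinder, mem_cylinder, Λ.deg_comp p q h, x.pre_add]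
  constructor
  · intro hx
    exact comp_inj (x.s_pre_eq_r_pre_shift _ _) h (x.deg_pre _) hx
  · rintro ⟨h1, h2⟩
    rw [h1, h2]

theorem s_eq_r_of_shift_mem {p q : Λ.P} {x : Λ.InfPath} (hp : x ∈ Λ.cylinder p)
    (hq : Λ.shift (Λ.deg p) x ∈ Λ.cylinder q) : Λ.s p = Λ.r q := by
  rw [mem_cylinder] at hp hq
  have := x.s_pre_eq_r_pre_shift (Λ.deg p) (Λ.deg q)
  rwa [hp, hq] at this

/-- For an infinite path x in both cylinders, x(0, n) would be the initial segment of degree n of p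
and of q. -/
theorem disjoint_cylinder {p q : Λ.P} {n : Fin k → ℕ} (hp : n ≤ Λ.deg p) (hq : n ≤ Λ.deg q)
    (h : head p n ≠ head q n) : Disjoint (Λ.cylinder p) (Λ.cylinder q) := by
  refine Set.disjoint_left.2 fun x hxp hxq => h ?_
  rw [mem_cylinder] at hxp hxq
  rw [← hxp, ← hxq, x.head_pre hp, x.head_pre hq]

theorem cylinder_subset_cylinder_head {p : Λ.P} {n : Fin k → ℕ} (h : n ≤ Λ.deg p) :
    Λ.cylinder p ⊆ Λ.cylinder (head p n) := by
  intro x hx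
  rw [mem_cylinder] at hx
  rw [mem_cylinder_iff (deg_head h), ← x.head_pre h, hx]

theorem disjoint_cylinder_of_ne {p q : Λ.P} (hd : Λ.deg p = Λ.deg q) (h : p ≠ q) :
    Disjoint (Λ.cylinder p) (Λ.cylinder q) := by
  refine disjoint_cylinder le_rfl hd.le ?_
  rwa [head_self, hd, head_self]

theorem disjoint_cylinder_of_r_ne {p q : Λ.P} (h : Λ.r p ≠ Λ.r q) :
    Disjoint (Λ.cylinder p) (Λ.cylinder q) := by
  refine disjoint_cylinder zero_le zero_le fun e => h ?_
  rw [head_zero, head_zero] at e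
  rw [← Λ.r_id (Λ.r p), e, Λ.r_id]

section Finite

variable [Λ.IsFinite]

theorem mem_pathsTo {v : Λ.V} {n : Fin k → ℕ} {p : Λ.P} :
    p ∈ Λ.pathsTo v n ↔ Λ.r p = v ∧ Λ.deg p = n := by
  simp [pathsTo]

/-- `[p]` is the disjoint union of the `[pq]` with `q ∈ s(p) Λ^n`. -/
theorem cylinder_eq_iUnion (p : Λ.P) (n : Fin k → ℕ) :
    Λ.cylinder p = ⋃ q ∈ Λ.pathsTo (Λ.s p) n, Λ.cylinder (Λ.comp p q) := by
  ext x
  simp only [Set.mem_iUnion, exists_prop]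
  constructor
  · intro hx
    have h1 : Λ.s p = Λ.r ((Λ.shift (Λ.deg p) x).pre n) :=
      s_eq_r_of_shift_mem hx (mem_cylinder_of_pre rfl)
    exact ⟨(Λ.shift (Λ.deg p) x).pre n, mem_pathsTo.2 ⟨h1.symm, InfPath.deg_pre _ _⟩,
      (mem_cylinder_comp h1).2 ⟨hx, mem_cylinder_of_pre rfl⟩⟩
  · rintro ⟨q, hq, hx⟩
    exact ((mem_cylinder_comp (mem_pathsTo.1 hq).1.symm).1 hx).1

theorem pairwiseDisjoint_cylinder_comp (p : Λ.P) (n : Fin k → ℕ) :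
    (Λ.pathsTo (Λ.s p) n : Set Λ.P).PairwiseDisjoint fun q => Λ.cylinder (Λ.comp p q) := by
  intro q hq q' hq' hne
  have h1 := mem_pathsTo.1 hq
  have h2 := mem_pathsTo.1 hq'
  refine disjoint_cylinder_of_ne ?_ fun e => hne (comp_inj h1.1.symm h2.1.symm rfl e).2
  rw [Λ.deg_comp _ _ h1.1.symm, Λ.deg_comp _ _ h2.1.symm, h1.2, h2.2]

end Finite

end Combinatorics

end KGraph

/-! ### Perron-Frobenius theory -/

section PositiveMap

variable {ι : Type*} [Fintype ι]

/-- A linear map that sends nonzero nonnegative vectors to positive vectors. -/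
def IsStrictlyPositiveMap (L : (ι → ℝ) →ₗ[ℝ] (ι → ℝ)) : Prop :=
  ∀ x : ι → ℝ, 0 ≤ x → x ≠ 0 → ∀ i, 0 < L x i

theorem exists_pos_forall_mul_le [Nonempty ι] (a b : ι → ℝ) (hb : ∀ i, 0 < b i) :
    ∃ ε > 0, ∀ i, ε * a i ≤ b i := by
  have h : ∀ i, ∀ᶠ ε in 𝓝[>] (0 : ℝ), ε * a i ≤ b i := fun i => by
    have h1 : Tendsto (fun ε : ℝ => ε * a i) (𝓝 0) (𝓝 (0 * a i)) :=
      (continuous_id.mul continuous_const).tendsto 0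
    rw [zero_mul] at h1
    filter_upwards [nhdsWithin_le_nhds (h1.eventually_lt_const (hb i))] with ε hε using hε.le
  obtain ⟨ε, hε, h0⟩ := ((eventually_all.2 h).and self_mem_nhdsWithin).exists
  exact ⟨ε, h0, hε⟩

/-- The Collatz-Wielandt argument: maximize c over the pairs (x, c) with x in the simplex and c x ≤
L x. If L x ≠ c x at the maximum, then L maps the nonzero vector L x - c x ≥ 0 to a positive one, so
the normalized vector L x admits a larger c. -/
theorem IsStrictlyPositiveMap.exists_eigenvector [Nonempty ι] {L : (ι → ℝ) →ₗ[ℝ] (ι → ℝ)}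
    (hL : IsStrictlyPositiveMap L) :
    ∃ (x : ι → ℝ) (c : ℝ), (∀ i, 0 < x i) ∧ ∑ i, x i = 1 ∧ L x = c • x := by
  classical
  have hLc : Continuous L := L.continuous_of_finiteDimensional
  -- Summing c x ≤ L x over the coordinates gives c ≤ ∑ (L x)_i, so a bound for this sum on the
  -- simplex bounds c and makes the set K below compact.
  obtain ⟨C, hC⟩ := (isCompact_stdSimplex ℝ ι).bddAbove_image
    (f := fun x => ∑ i, L x i) (by fun_prop)
  have hC' : ∀ x ∈ stdSimplex ℝ ι, ∑ i, L x i ≤ C := fun x hx => hC ⟨x, hx, rfl⟩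
  have hbd : ∀ x ∈ stdSimplex ℝ ι, ∀ c : ℝ, (∀ i, c * x i ≤ L x i) → c ≤ C := by
    intro x hx c hc
    refine le_trans ?_ (hC' x hx)
    have := Finset.sum_le_sum fun i (_ : i ∈ Finset.univ) => hc i
    rwa [← Finset.mul_sum, hx.2, mul_one] at this
  have hne0 : ∀ x ∈ stdSimplex ℝ ι, x ≠ 0 := by
    rintro x hx rfl
    simpa using hx.2
  let K : Set ((ι → ℝ) × ℝ) :=
    (stdSimplex ℝ ι ×ˢ Set.Icc 0 C) ∩ {z | ∀ i, z.2 * z.1 i ≤ L z.1 i}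
  have hK : IsCompact K := by
    refine ((isCompact_stdSimplex ℝ ι).prod isCompact_Icc).inter_right ?_
    rw [Set.ofPred_forall]
    exact isClosed_iInter fun i => isClosed_le (by fun_prop) (by fun_prop)
  have hKne : K.Nonempty := by
    obtain ⟨i⟩ := ‹Nonempty ι›
    have h1 := single_mem_stdSimplex ℝ i
    have h2 := fun j => (hL _ h1.1 (hne0 _ h1) j).le
    have h3 : ∀ j, (0 : ℝ) * (Pi.single i 1 : ι → ℝ) j ≤ L (Pi.single i 1) j := by
      simpa using h2
    exact ⟨(Pi.single i 1, 0), ⟨h1, le_rfl, hbd _ h1 0 h3⟩, h3⟩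
  obtain ⟨⟨x, c⟩, ⟨⟨hx, hc⟩, hxc⟩, hmax⟩ := hK.exists_isMaxOn hKne continuous_snd.continuousOn
  have hLx := hL x hx.1 (hne0 x hx)
  have heq : L x = c • x := by
    by_contra hne
    have hz : 0 ≤ L x - c • x := fun i => sub_nonneg.2 (hxc i)
    have hLz := hL _ hz (sub_ne_zero.2 hne)
    obtain ⟨ε, hε, h⟩ := exists_pos_forall_mul_le (L x) _ hLz
    have hs : 0 < ∑ i, L x i := Finset.sum_pos (fun i _ => hLx i) Finset.univ_nonempty
    have hy : (∑ i, L x i)⁻¹ • L x ∈ stdSimplex ℝ ι := by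
      refine ⟨fun i => (mul_pos (inv_pos.2 hs) (hLx i)).le, ?_⟩
      simp only [Pi.smul_apply, smul_eq_mul]
      rw [← Finset.mul_sum, inv_mul_cancel₀ hs.ne']
    have hyc : ∀ i, (c + ε) * ((∑ i, L x i)⁻¹ • L x) i ≤ L ((∑ i, L x i)⁻¹ • L x) i := by
      intro i
      have h1 := h i
      simp only [map_sub, map_smul, Pi.sub_apply, Pi.smul_apply, smul_eq_mul] at h1 ⊢
      have h2 : (c + ε) * L x i ≤ L (L x) i := by linarith
      calc (c + ε) * ((∑ i, L x i)⁻¹ * L x i) = (∑ i, L x i)⁻¹ * ((c + ε) * L x i) := by ring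
        _ ≤ _ := mul_le_mul_of_nonneg_left h2 (inv_pos.2 hs).le
    have hmem : ((∑ i, L x i)⁻¹ • L x, c + ε) ∈ K :=
      ⟨⟨hy, add_nonneg hc.1 hε.le, hbd _ hy _ hyc⟩, hyc⟩
    have := hmax hmem
    simp only [Set.mem_ofPred_eq] at this
    linarith
  refine ⟨x, c, fun i => ?_, hx.2, heq⟩
  have h1 := hLx i
  rw [heq] at h1
  exact pos_of_mul_pos_right h1 hc.1

/-- Let t be the least ratio y_i / x_i. Then y - t x ≥ 0 vanishes at some coordinate i. Were it
nonzero, its image c (y - t x) would be positive at i. -/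
theorem IsStrictlyPositiveMap.eq_smul [Nonempty ι] {L : (ι → ℝ) →ₗ[ℝ] (ι → ℝ)}
    (hL : IsStrictlyPositiveMap L) {x y : ι → ℝ} {c : ℝ} (hx : ∀ i, 0 < x i) (hxc : L x = c • x)
    (hyc : L y = c • y) : ∃ t : ℝ, y = t • x := by
  obtain ⟨i, hi⟩ := Finite.exists_min fun i => y i / x i
  refine ⟨y i / x i, ?_⟩
  by_contra hne
  have hz : 0 ≤ y - (y i / x i) • x := fun j => by
    have := (le_div_iff₀ (hx j)).1 (hi j)
    simpa using this
  have h1 := hL _ hz (sub_ne_zero.2 hne) i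
  rw [map_sub, map_smul, hxc, hyc] at h1
  have h2 : y i / x i * x i = y i := div_mul_cancel₀ _ (hx i).ne'
  simp only [Pi.sub_apply, Pi.smul_apply, smul_eq_mul] at h1
  have h3 : c * y i - y i / x i * (c * x i) = c * (y i - y i / x i * x i) := by ring
  rw [h3, h2, sub_self, mul_zero] at h1
  exact lt_irrefl _ h1

/-- If a nonnegative matrix has a positive eigenvector, then the eigenvalue is the spectral
radius. -/
theorem spectralRadius_eq_of_pos_eigenvector [Nonempty ι] [DecidableEq ι] (A : Matrix ι ι ℕ)
    {x : ι → ℝ} {c : ℝ} (hx : ∀ i, 0 < x i)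
    (hxc : (A.map (fun a : ℕ => (a : ℝ))).mulVec x = c • x) :
    spectralRadius ℂ (A.map (fun a : ℕ => (a : ℂ))) = ENNReal.ofReal c := by
  have hxc' : ∀ i, ∑ j, (A i j : ℝ) * x j = c * x i := fun i => congrFun hxc i
  have hc : 0 ≤ c := by
    obtain ⟨i⟩ := ‹Nonempty ι›
    refine nonneg_of_mul_nonneg_left ?_ (hx i)
    rw [← hxc' i]
    exact Finset.sum_nonneg fun j _ => mul_nonneg (Nat.cast_nonneg _) (hx j).le
  have hspec : ∀ z : ℂ, z ∈ spectrum ℂ (A.map (fun a : ℕ => (a : ℂ))) ↔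
      ∃ v : ι → ℂ, v ≠ 0 ∧ (A.map (fun a : ℕ => (a : ℂ))).mulVec v = z • v := by
    intro z
    rw [← Matrix.spectrum_toLin', ← Module.End.hasEigenvalue_iff_mem_spectrum]
    constructor
    · intro h
      obtain ⟨v, hv⟩ := h.exists_hasEigenvector
      exact ⟨v, hv.2, by simpa using hv.apply_eq_smul⟩
    · rintro ⟨v, hv, h⟩
      exact Module.End.hasEigenvalue_of_hasEigenvector
        ⟨Module.End.mem_eigenspace_iff.2 (by simpa using h), hv⟩
  apply le_antisymm
  · refine iSup₂_le fun z hz => ?_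
    obtain ⟨v, hv, h⟩ := (hspec z).1 hz
    -- Where |v_i| / x_i is largest, the i-th coordinate of A v = z v gives |z| |v_i| ≤ ∑ A_ij
    -- (|v_i| / x_i) x_j = c |v_i|.
    obtain ⟨i, hi⟩ := Finite.exists_max fun i => ‖v i‖ / x i
    have hvi : 0 < ‖v i‖ := by
      by_contra hcon
      refine hv (funext fun j => ?_)
      have h1 : ‖v i‖ = 0 := le_antisymm (not_lt.1 hcon) (norm_nonneg _)
      have h2 := hi j
      rw [h1, zero_div] at h2
      have h3 := (div_le_iff₀ (hx j)).1 h2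
      rw [zero_mul] at h3
      exact norm_le_zero_iff.1 h3
    have h1 : ‖z‖ * ‖v i‖ ≤ c * ‖v i‖ := by
      have h2 : z * v i = ∑ j, (A i j : ℂ) * v j := (congrFun h i).symm
      rw [← norm_mul, h2]
      calc ‖∑ j, (A i j : ℂ) * v j‖ ≤ ∑ j, ‖(A i j : ℂ) * v j‖ := norm_sum_le _ _
        _ ≤ ∑ j, ‖v i‖ / x i * ((A i j : ℝ) * x j) := by
          refine Finset.sum_le_sum fun j _ => ?_
          rw [norm_mul, Complex.norm_natCast, mul_left_comm]
          exact mul_le_mul_of_nonneg_left ((div_le_iff₀ (hx j)).1 (hi j)) (Nat.cast_nonneg _)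
        _ = c * ‖v i‖ := by
          rw [← Finset.mul_sum, hxc', mul_left_comm, div_mul_cancel₀ _ (hx i).ne']
    have h3 : ‖z‖ ≤ c := le_of_mul_le_mul_right h1 hvi
    rw [← enorm_eq_nnnorm, ← ofReal_norm]
    exact ENNReal.ofReal_le_ofReal h3
  · have hmem : (c : ℂ) ∈ spectrum ℂ (A.map (fun a : ℕ => (a : ℂ))) := by
      refine (hspec c).2 ⟨fun i => (x i : ℂ), fun h => ?_, funext fun i => ?_⟩
      · obtain ⟨i⟩ := ‹Nonempty ι›
        exact (hx i).ne' (by simpa using congrFun h i)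
      · have := congrArg (fun t : ℝ => (t : ℂ)) (hxc' i)
        simp only [Complex.ofReal_sum, Complex.ofReal_mul, Complex.ofReal_natCast] at this
        exact this
    refine le_trans ?_ (le_iSup₂ (f := fun (z : ℂ) (_ : z ∈ spectrum ℂ _) => (‖z‖₊ : ℝ≥0∞))
      (c : ℂ) hmem)
    rw [← enorm_eq_nnnorm, ← ofReal_norm, Complex.norm_real, Real.norm_of_nonneg hc]

end PositiveMap

namespace KGraph

variable {k : ℕ}

/-! ### The Perron-Frobenius vector of a strongly connected graph -/

section PerronFrobenius

variable {Λ : KGraph.{u} k} [Λ.IsFinite]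

theorem sum_pathsTo_add {E : Type*} [AddCommMonoid E] (f : Λ.P → E) (v : Λ.V)
    (m n : Fin k → ℕ) :
    ∑ p ∈ Λ.pathsTo v (m + n), f p =
      ∑ p ∈ Λ.pathsTo v m, ∑ q ∈ Λ.pathsTo (Λ.s p) n, f (Λ.comp p q) := by
  rw [Finset.sum_sigma']
  symm
  refine Finset.sum_bij (fun t _ => Λ.comp t.1 t.2) ?_ ?_ ?_ ?_
  · rintro ⟨p, q⟩ h
    obtain ⟨⟨h1, h2⟩, h3, h4⟩ := by simpa [mem_pathsTo] using h
    exact mem_pathsTo.2 ⟨by rw [Λ.r_comp _ _ h3.symm, h1], by rw [Λ.deg_comp _ _ h3.symm, h2, h4]⟩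
  · rintro ⟨p, q⟩ h ⟨p', q'⟩ h' e
    obtain ⟨⟨h1, h2⟩, h3, h4⟩ := by simpa [mem_pathsTo] using h
    obtain ⟨⟨h1', h2'⟩, h3', h4'⟩ := by simpa [mem_pathsTo] using h'
    obtain ⟨rfl, rfl⟩ := comp_inj h3.symm h3'.symm (h2.trans h2'.symm) e
    rfl
  · intro p hp
    obtain ⟨h1, h2⟩ := mem_pathsTo.1 hp
    have h3 : m ≤ Λ.deg p := h2 ▸ le_self_add
    refine ⟨⟨head p m, tail p m⟩, ?_, head_comp_tail h3⟩
    simp only [Finset.mem_sigma, mem_pathsTo]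
    exact ⟨⟨by rw [r_head h3, h1], deg_head h3⟩, (s_head h3).symm, by
      rw [deg_tail h3, h2, add_tsub_cancel_left]⟩
  · intros; rfl

theorem pathsTo_zero (v : Λ.V) : Λ.pathsTo v 0 = {Λ.id v} := by
  ext p
  rw [mem_pathsTo, Finset.mem_singleton]
  constructor
  · rintro ⟨rfl, h⟩
    exact eq_id_of_deg_eq_zero h
  · rintro rfl
    exact ⟨Λ.r_id v, Λ.deg_id v⟩

/-- The action of the matrix `(#(v Λ^n w))_{v,w}` on vectors. -/
def pathSum (n : Fin k → ℕ) : (Λ.V → ℝ) →ₗ[ℝ] (Λ.V → ℝ) where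
  toFun x v := ∑ p ∈ Λ.pathsTo v n, x (Λ.s p)
  map_add' x y := funext fun v => by simp [Finset.sum_add_distrib]
  map_smul' c x := funext fun v => by simp [Finset.mul_sum]

theorem pathSum_apply (n : Fin k → ℕ) (x : Λ.V → ℝ) (v : Λ.V) :
    pathSum n x v = ∑ p ∈ Λ.pathsTo v n, x (Λ.s p) := rfl

theorem pathSum_add (m n : Fin k → ℕ) (x : Λ.V → ℝ) :
    pathSum (m + n) x = pathSum m (pathSum n x) := by
  funext v
  rw [pathSum_apply, sum_pathsTo_add, pathSum_apply]
  refine Finset.sum_congr rfl fun p _ => Finset.sum_congr rfl fun q hq => ?_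
  rw [Λ.s_comp _ _ (mem_pathsTo.1 hq).1.symm]

theorem pathSum_comm (m n : Fin k → ℕ) (x : Λ.V → ℝ) :
    pathSum m (pathSum n x) = pathSum n (pathSum m x) := by
  rw [← pathSum_add, add_comm, pathSum_add]

theorem pathSum_zero (x : Λ.V → ℝ) : pathSum 0 x = x := by
  funext v
  rw [pathSum_apply, pathsTo_zero, Finset.sum_singleton, Λ.s_id]

theorem adj_mulVec (i : Fin k) (x : Λ.V → ℝ) :
    ((Λ.adj i).map (fun a : ℕ => (a : ℝ))).mulVec x = pathSum (Pi.single i 1) x := by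
  funext v
  rw [pathSum_apply, ← Finset.sum_fiberwise_of_maps_to (t := Finset.univ) (g := Λ.s)
    (fun _ _ => Finset.mem_univ _)]
  refine Finset.sum_congr rfl fun w _ => ?_
  rw [Finset.sum_congr rfl fun p hp => by rw [(Finset.mem_filter.1 hp).2],
    Finset.sum_const, nsmul_eq_mul]
  change ((Λ.adj i v w : ℕ) : ℝ) * x w = _
  rw [adj]
  congr 2
  rw [← Set.ncard_coe_finset]
  congr 1
  ext p
  simp only [Finset.coe_filter, mem_pathsTo, Set.mem_ofPred_eq]
  tauto

theorem pathSum_nonneg (n : Fin k → ℕ) {x : Λ.V → ℝ} (hx : 0 ≤ x) : 0 ≤ pathSum n x :=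
  fun _ => Finset.sum_nonneg fun _ _ => hx _

theorem le_pathSum {x : Λ.V → ℝ} (hx : 0 ≤ x) (p : Λ.P) :
    x (Λ.s p) ≤ pathSum (Λ.deg p) x (Λ.r p) :=
  Finset.single_le_sum (f := fun p => x (Λ.s p)) (fun _ _ => hx _) (mem_pathsTo.2 ⟨rfl, rfl⟩)

/-- Choose a path from w to v for each pair (v, w) and add the path-counting maps of its degree: a
coordinate x_w > 0 then contributes to every coordinate of L x. The form of L as a sum of maps
`pathSum` is recorded because it makes L commute with all of them. -/
theorem exists_strictlyPositive (hconn : Λ.StronglyConnected) :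
    ∃ L : (Λ.V → ℝ) →ₗ[ℝ] (Λ.V → ℝ), IsStrictlyPositiveMap L ∧
      ∃ S : Λ.V × Λ.V → Fin k → ℕ, L = ∑ t, pathSum (S t) := by
  choose c hr hs using hconn
  refine ⟨∑ t : Λ.V × Λ.V, pathSum (Λ.deg (c t.1 t.2)), fun x hx hne v => ?_, _, rfl⟩
  obtain ⟨w, hw⟩ := Function.ne_iff.1 hne
  have hw' : 0 < x w := lt_of_le_of_ne (hx w) (Ne.symm hw)
  rw [LinearMap.sum_apply, Finset.sum_apply]
  refine lt_of_lt_of_le hw' ?_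
  refine le_trans ?_ (Finset.single_le_sum
    (f := fun t : Λ.V × Λ.V => pathSum (Λ.deg (c t.1 t.2)) x v)
    (fun t _ => pathSum_nonneg _ hx v) (Finset.mem_univ (v, w)))
  have h := le_pathSum hx (c v w)
  rwa [hr, hs] at h

theorem rho_eq [Nonempty Λ.V] {x : Λ.V → ℝ} (hx : ∀ v, 0 < x v) {i : Fin k} {c : ℝ}
    (h : pathSum (Pi.single i 1) x = c • x) : Λ.rho i = c := by
  have hc : 0 ≤ c := by
    obtain ⟨v⟩ := ‹Nonempty Λ.V›
    refine nonneg_of_mul_nonneg_left ?_ (hx v)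
    have h1 := pathSum_nonneg (Pi.single i 1) (fun v => (hx v).le) v
    rwa [h] at h1
  rw [rho, spectralRadius_eq_of_pos_eigenvector _ hx ((adj_mulVec i x).trans h),
    ENNReal.toReal_ofReal hc]

theorem rhoPow_zero : Λ.rhoPow 0 = 1 := by simp [rhoPow]

theorem rhoPow_add (m n : Fin k → ℕ) : Λ.rhoPow (m + n) = Λ.rhoPow m * Λ.rhoPow n := by
  simp [rhoPow, pow_add, Finset.prod_mul_distrib]

theorem rhoPow_single (i : Fin k) : Λ.rhoPow (Pi.single i 1) = Λ.rho i := by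
  rw [rhoPow, Finset.prod_eq_single i]
  · simp
  · intro j _ hj
    simp [hj]
  · simp

theorem IsPerronFrobenius.pathSum_eq {x : Λ.V → ℝ} (h : Λ.IsPerronFrobenius x)
    (n : Fin k → ℕ) : pathSum n x = Λ.rhoPow n • x := by
  have hstep : ∀ (m : Fin k → ℕ) (i : Fin k), pathSum m x = Λ.rhoPow m • x →
      pathSum (m + Pi.single i 1) x = Λ.rhoPow (m + Pi.single i 1) • x := by
    intro m i hm
    rw [pathSum_add, ← adj_mulVec, h.2.2 i, map_smul, hm, rhoPow_add, rhoPow_single, smul_smul,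
      mul_comm]
  have hmul : ∀ (m : Fin k → ℕ) (i : Fin k) (a : ℕ), pathSum m x = Λ.rhoPow m • x →
      pathSum (m + Pi.single i a) x = Λ.rhoPow (m + Pi.single i a) • x := by
    intro m i a hm
    induction a with
    | zero => simpa using hm
    | succ a ih =>
      rw [Pi.single_add, ← add_assoc]
      exact hstep _ i ih
  have hsum : ∀ s : Finset (Fin k), pathSum (∑ i ∈ s, Pi.single i (n i)) x =
      Λ.rhoPow (∑ i ∈ s, Pi.single i (n i)) • x := by
    intro s
    classical
    induction s using Finset.induction_on with
    | empty => rw [Finset.sum_empty, pathSum_zero, rhoPow_zero, one_smul]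
    | insert i s hi ih =>
      rw [Finset.sum_insert hi, add_comm]
      exact hmul _ i _ ih
  have := hsum Finset.univ
  rwa [Finset.univ_sum_single] at this

/-- The positive eigenvector x of the strictly positive map L spans its eigenspace. Each A_i
commutes with L, so A_i x is a multiple of x, and positivity of x identifies the factor as ρ_i.
Conversely, every Perron-Frobenius vector is an eigenvector of L for the same eigenvalue ∑ ρ(Λ)^{S
t}, hence a multiple of x, and the normalization fixes it. -/
theorem existsUnique_perronFrobenius [Nonempty Λ.V] (hconn : Λ.StronglyConnected) :
    ∃! x, Λ.IsPerronFrobenius x := by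
  obtain ⟨L, hL, S, hS⟩ := exists_strictlyPositive hconn
  obtain ⟨x, c, hx, hx1, hxc⟩ := hL.exists_eigenvector
  have hcomm : ∀ n y, L (pathSum n y) = pathSum n (L y) := by
    intro n y
    rw [hS, LinearMap.sum_apply, LinearMap.sum_apply, map_sum]
    exact Finset.sum_congr rfl fun t _ => pathSum_comm _ _ _
  have hPF : Λ.IsPerronFrobenius x := by
    refine ⟨hx, hx1, fun i => ?_⟩
    obtain ⟨t, ht⟩ := hL.eq_smul (y := pathSum (Pi.single i 1) x) hx hxc
      (by rw [hcomm, hxc, map_smul])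
    rw [adj_mulVec, ht, rho_eq hx ht]
  refine ⟨x, hPF, fun y hy => ?_⟩
  have hLy : ∀ z, Λ.IsPerronFrobenius z → L z = (∑ t, Λ.rhoPow (S t)) • z := by
    intro z hz
    rw [hS, LinearMap.sum_apply, Finset.sum_smul]
    exact Finset.sum_congr rfl fun t _ => hz.pathSum_eq _
  obtain ⟨t, rfl⟩ := hL.eq_smul hx (hLy x hPF) (hLy y hy)
  have h1 := hy.2.1
  simp only [Pi.smul_apply, smul_eq_mul] at h1
  rw [← Finset.mul_sum, hx1, mul_one] at h1
  rw [h1, one_smul]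

theorem pfVector_isPerronFrobenius [Nonempty Λ.V] (hconn : Λ.StronglyConnected) :
    Λ.IsPerronFrobenius Λ.pfVector := by
  have h := (existsUnique_perronFrobenius hconn).exists
  rw [pfVector, dif_pos h]
  exact h.choose_spec

/-- A path of degree n with range v and source w contributes x_w > 0 to ρ(Λ)^n x_v. -/
theorem IsPerronFrobenius.rhoPow_pos [Nonempty Λ.V] {x : Λ.V → ℝ} (h : Λ.IsPerronFrobenius x)
    (hsrc : Λ.NoSources) (n : Fin k → ℕ) : 0 < Λ.rhoPow n := by
  obtain ⟨v⟩ := ‹Nonempty Λ.V›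
  obtain ⟨p, hp, hn⟩ := hsrc v n
  have h1 := le_pathSum (fun v => (h.1 v).le) p
  rw [h.pathSum_eq, hn] at h1
  exact pos_of_mul_pos_left ((h.1 _).trans_le h1) (h.1 _).le

end PerronFrobenius

end KGraph

/-! ### The measure on the infinite path space -/

section Partition

theorem measurable_of_generateFrom {α β : Type*} [MeasurableSpace α] [m : MeasurableSpace β]
    {C : Set (Set β)} (h : m = MeasurableSpace.generateFrom C) {f : α → β}
    (hf : ∀ A ∈ C, MeasurableSet (f ⁻¹' A)) : Measurable f := by
  subst h
  exact measurable_generateFrom hf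

theorem measurableSet_preimage_singleton_of_const {ι : Type*} (a i : ι) :
    MeasurableSet ((fun _ : ℝ => a) ⁻¹' {i}) := by
  classical
  rw [Set.preimage_const]
  split_ifs
  exacts [MeasurableSet.univ, MeasurableSet.empty]

/-- Since μ is dominated by Lebesgue measure, t ↦ μ(S ∩ (-∞, t]) is 1-Lipschitz. It is 0 at 0 and
μ(S) at 1, so the intermediate value theorem applies; S need not be measurable. -/
theorem exists_measure_inter_Iic_eq (μ : Measure ℝ) (hμ : μ = volume.restrict (Set.Icc 0 1))
    (S : Set ℝ) (c : ℝ≥0∞) (hc : c ≤ μ S) : ∃ t, μ (S ∩ Set.Iic t) = c := by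
  have hfin : IsFiniteMeasure μ := by
    rw [hμ]
    infer_instance
  have hle : μ ≤ volume := hμ ▸ Measure.restrict_le_self
  let g : ℝ → ℝ := fun t => μ.real (S ∩ Set.Iic t)
  have hg : ∀ s t, s ≤ t → g t ≤ g s + (t - s) := by
    intro s t hst
    have h1 : S ∩ Set.Iic t ⊆ (S ∩ Set.Iic s) ∪ Set.Ioc s t := by
      rintro x ⟨hx, hxt⟩
      rcases le_or_gt x s with h | h
      · exact Or.inl ⟨hx, h⟩
      · exact Or.inr ⟨h, hxt⟩
    have h2 : μ.real (Set.Ioc s t) ≤ t - s := by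
      refine ENNReal.toReal_le_of_le_ofReal (sub_nonneg.2 hst) ?_
      rw [← Real.volume_Ioc]
      exact hle _
    have h3 : g t ≤ μ.real ((S ∩ Set.Iic s) ∪ Set.Ioc s t) := measureReal_mono h1
    have h4 := measureReal_union_le (μ := μ) (S ∩ Set.Iic s) (Set.Ioc s t)
    linarith
  have hmono : ∀ s t, s ≤ t → g s ≤ g t := fun s t hst =>
    measureReal_mono (Set.inter_subset_inter_right _ (Set.Iic_subset_Iic.2 hst))
  have hcont : Continuous g := by
    refine (LipschitzWith.of_dist_le_mul (K := 1) fun s t => ?_).continuous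
    rw [NNReal.coe_one, one_mul, Real.dist_eq, Real.dist_eq]
    rcases le_total s t with h | h
    · rw [abs_sub_comm, abs_sub_comm s t, abs_of_nonneg (sub_nonneg.2 (hmono s t h)),
        abs_of_nonneg (sub_nonneg.2 h)]
      linarith [hg s t h]
    · rw [abs_of_nonneg (sub_nonneg.2 (hmono t s h)), abs_of_nonneg (sub_nonneg.2 h)]
      linarith [hg t s h]
  have hcfin : c ≠ ∞ := (hc.trans_lt (measure_lt_top μ S)).ne
  have h0 : g 0 = 0 := by
    have : μ (Set.Iic 0) = 0 := by
      rw [hμ, Measure.restrict_apply measurableSet_Iic]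
      refine measure_mono_null (t := {0}) ?_ (by simp)
      rintro x ⟨hx, hx'⟩
      exact le_antisymm hx hx'.1
    simp only [g, measureReal_def]
    rw [measure_mono_null Set.inter_subset_right this, ENNReal.toReal_zero]
  have h1 : g 1 = μ.real S := by
    have : μ (Set.Iic 1)ᶜ = 0 := by
      rw [hμ, Measure.restrict_apply measurableSet_Iic.compl]
      refine measure_mono_null (t := ∅) ?_ measure_empty
      rintro x ⟨hx, hx'⟩
      exact hx hx'.2
    simp only [g, measureReal_def]
    rw [measure_inter_conull this]
  obtain ⟨t, -, ht⟩ := intermediate_value_Icc zero_le_one hcont.continuousOn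
    (show c.toReal ∈ Set.Icc (g 0) (g 1) by
      rw [h0, h1]
      exact ⟨ENNReal.toReal_nonneg, ENNReal.toReal_mono (measure_ne_top _ _) hc⟩)
  exact ⟨t, (ENNReal.toReal_eq_toReal_iff' (measure_ne_top _ _) hcfin).1 ht⟩

/-- The pieces are cut off by half-lines, one index at a time. The labelling f is total with values
in s, also outside S, so that in the applications every real number carries a label. -/
theorem exists_partition_of_sum_eq (μ : Measure ℝ) (hμ : μ = volume.restrict (Set.Icc 0 1))
    {ι : Type*} (s : Finset ι) (hs : s.Nonempty) (w : ι → ℝ≥0∞) :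
    ∀ S : Set ℝ, MeasurableSet S → ∑ i ∈ s, w i = μ S →
      ∃ f : ℝ → ι, (∀ i, MeasurableSet (f ⁻¹' {i})) ∧ (∀ t, f t ∈ s) ∧
        ∀ i ∈ s, μ (S ∩ f ⁻¹' {i}) = w i := by
  classical
  have hfin : IsFiniteMeasure μ := by
    rw [hμ]
    infer_instance
  induction hs using Finset.Nonempty.cons_induction with
  | singleton a =>
    intro S _ h
    refine ⟨fun _ => a, fun i => measurableSet_preimage_singleton_of_const _ i,
      fun _ => Finset.mem_singleton_self a, fun i hi => ?_⟩
    rw [Finset.mem_singleton.1 hi, Set.preimage_const_of_mem (Set.mem_singleton a),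
      Set.inter_univ, ← h, Finset.sum_singleton]
  | cons a s ha hs ih =>
    intro S hS h
    rw [Finset.sum_cons] at h
    obtain ⟨t, ht⟩ := exists_measure_inter_Iic_eq μ hμ S (w a) (h ▸ le_self_add)
    have hrest : ∑ i ∈ s, w i = μ (S \ Set.Iic t) := by
      have h1 := measure_inter_add_sdiff (μ := μ) S (measurableSet_Iic (a := t))
      rw [ht, ← h] at h1
      refine ((ENNReal.add_right_inj ?_).1 h1).symm
      rw [← ht]
      exact measure_ne_top _ _
    obtain ⟨f, hf, hfs, hfw⟩ := ih _ (hS.diff measurableSet_Iic) hrest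
    have hpre : ∀ i, (fun x => if x ≤ t then a else f x) ⁻¹' {i} =
        (if a = i then Set.Iic t else ∅) ∪ ((Set.Iic t)ᶜ ∩ f ⁻¹' {i}) := by
      intro i
      ext x
      by_cases hx : x ≤ t <;> by_cases hai : a = i <;> simp [hx, hai, not_le.1, not_lt]
    refine ⟨fun x => if x ≤ t then a else f x, fun i => ?_, fun x => ?_, fun i hi => ?_⟩
    · rw [hpre]
      refine MeasurableSet.union ?_ (measurableSet_Iic.compl.inter (hf i))
      split_ifs
      exacts [measurableSet_Iic, MeasurableSet.empty]
    · by_cases hx : x ≤ t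
      · simp [hx]
      · simp [hx, hfs x]
    · rcases Finset.mem_cons.1 hi with rfl | his
      · have hemp : f ⁻¹' {i} = ∅ := by
          refine Set.eq_empty_of_forall_notMem fun x hx => ha ?_
          have := hfs x
          rwa [show f x = i from hx] at this
        rw [hpre, hemp, if_pos rfl, Set.inter_empty, Set.union_empty, ht]
      · have hne : a ≠ i := fun e => ha (e ▸ his)
        rw [hpre, if_neg hne, Set.empty_union, ← Set.inter_assoc]
        exact hfw i his

end Partition

namespace KGraph

variable {k : ℕ}

/-! ### Cylinder sets as generators, and the construction of M -/

section PathMeasure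

variable {Λ : KGraph.{u} k}

theorem isOpen_cylinder (p : Λ.P) : IsOpen (Λ.cylinder p) :=
  TopologicalSpace.isOpen_generateFrom_of_mem ⟨p, rfl⟩

theorem measurableSet_cylinder (p : Λ.P) : MeasurableSet (Λ.cylinder p) :=
  (isOpen_cylinder p).measurableSet

instance : Countable Λ.P := Λ.countable

theorem measurableSpace_eq_generateFrom :
    (inferInstance : MeasurableSpace Λ.InfPath) =
      MeasurableSpace.generateFrom (Set.range Λ.cylinder) := by
  have : SecondCountableTopology Λ.InfPath := ⟨⟨_, Set.countable_range Λ.cylinder, rfl⟩⟩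
  exact borel_eq_generateFrom_of_subbasis rfl

variable (Λ) in
/-- The empty set and the cylinder sets of paths of degree `(n, …, n)`. -/
def diagCylinders : Set (Set Λ.InfPath) :=
  insert ∅ {A | ∃ (n : ℕ) (p : Λ.P), Λ.deg p = diag k n ∧ A = Λ.cylinder p}

/-- Degrees (n, …, n) are totally ordered, so two such cylinders are nested or disjoint. Cylinders
of incomparable degrees may instead meet in a union of several cylinders, which is why only diagonal
degrees are used. -/
theorem isPiSystem_diagCylinders : IsPiSystem Λ.diagCylinders := by
  rintro A (rfl | ⟨m, p, hp, rfl⟩) B (rfl | ⟨n, q, hq, rfl⟩) hne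
  · exact Or.inl (Set.empty_inter _)
  · exact Or.inl (Set.empty_inter _)
  · exact Or.inl (Set.inter_empty _)
  · have key : ∀ (m n : ℕ) (p q : Λ.P), Λ.deg p = diag k m → Λ.deg q = diag k n → m ≤ n →
        (Λ.cylinder p ∩ Λ.cylinder q).Nonempty → Λ.cylinder p ∩ Λ.cylinder q = Λ.cylinder q := by
      intro m n p q hp hq hmn hne
      have h1 : Λ.deg p ≤ Λ.deg q := by
        rw [hp, hq]
        exact diag_mono hmn
      have h2 : head q (Λ.deg p) = p := by
        by_contra h
        refine Set.not_disjoint_iff_nonempty_inter.2 hne (disjoint_cylinder le_rfl h1 ?_)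
        rw [head_self]
        exact fun e => h e.symm
      rw [Set.inter_eq_right]
      conv_rhs => rw [← h2]
      exact cylinder_subset_cylinder_head h1
    rcases le_total m n with h | h
    · exact Or.inr ⟨n, q, hq, key m n p q hp hq h hne⟩
    · rw [Set.inter_comm] at hne ⊢
      exact Or.inr ⟨m, p, hp, key n m q p hq hp h hne⟩

variable [Λ.IsFinite]

theorem deg_comp_diag {p q : Λ.P} {n : ℕ} (h : Λ.deg p ≤ diag k n)
    (hq : q ∈ Λ.pathsTo (Λ.s p) (diag k n - Λ.deg p)) : Λ.deg (Λ.comp p q) = diag k n := by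
  have h1 := mem_pathsTo.1 hq
  rw [Λ.deg_comp _ _ h1.1.symm, h1.2, add_tsub_cancel_of_le h]

theorem measurableSpace_eq_generateFrom_diagCylinders :
    (inferInstance : MeasurableSpace Λ.InfPath) =
      MeasurableSpace.generateFrom Λ.diagCylinders := by
  rw [measurableSpace_eq_generateFrom]
  apply le_antisymm
  · refine MeasurableSpace.generateFrom_le ?_
    rintro _ ⟨p, rfl⟩
    rw [cylinder_eq_iUnion p (diag k (∑ i, Λ.deg p i) - Λ.deg p)]
    refine Finset.measurableSet_biUnion _ fun q hq =>
      MeasurableSpace.measurableSet_generateFrom (Or.inr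
        ⟨∑ i, Λ.deg p i, Λ.comp p q, deg_comp_diag (le_diag_sum (Λ.deg p)) hq, rfl⟩)
  · refine MeasurableSpace.generateFrom_le ?_
    rintro _ (rfl | ⟨n, p, -, rfl⟩)
    · exact @MeasurableSet.empty _ (_)
    · exact MeasurableSpace.measurableSet_generateFrom ⟨p, rfl⟩

theorem univ_eq_iUnion_cylinder :
    (Set.univ : Set Λ.InfPath) = ⋃ v ∈ (Finset.univ : Finset Λ.V), Λ.cylinder (Λ.id v) := by
  symm
  refine Set.eq_univ_of_forall fun x => ?_
  simp only [Finset.mem_univ, Set.iUnion_true, Set.mem_iUnion]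
  refine ⟨x.obj 0, ?_⟩
  rw [mem_cylinder_iff (Λ.deg_id _)]
  exact x.map_id 0

/-- Two measures that agree and are finite on cylinder sets are equal. -/
theorem measure_ext_of_cylinder {μ ν : Measure Λ.InfPath}
    (hfin : ∀ p, μ (Λ.cylinder p) ≠ ∞) (h : ∀ p, μ (Λ.cylinder p) = ν (Λ.cylinder p)) : μ = ν := by
  have huniv : ∀ m : Measure Λ.InfPath, m Set.univ = ∑ v, m (Λ.cylinder (Λ.id v)) := by
    intro m
    rw [univ_eq_iUnion_cylinder, measure_biUnion_finset _ fun _ _ => measurableSet_cylinder _]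
    intro v _ w _ hvw
    refine disjoint_cylinder_of_r_ne ?_
    rwa [Λ.r_id, Λ.r_id]
  have : IsFiniteMeasure μ := ⟨by
    rw [huniv]
    exact ENNReal.sum_lt_top.2 fun v _ => (hfin _).lt_top⟩
  refine ext_of_generate_finite Λ.diagCylinders measurableSpace_eq_generateFrom_diagCylinders
    isPiSystem_diagCylinders ?_ ?_
  · rintro _ (rfl | ⟨n, p, -, rfl⟩)
    · simp
    · exact h p
  · rw [huniv, huniv]
    exact Finset.sum_congr rfl fun v _ => h _

theorem IsPathMeasure.cylinder_ne_top {μ : Measure Λ.InfPath} (h : Λ.IsPathMeasure μ) (p : Λ.P) :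
    μ (Λ.cylinder p) ≠ ∞ := by
  rw [h p]
  exact ENNReal.ofReal_ne_top

variable (Λ) in
/-- The measure that the cylinder set of `p` has to have. -/
def weight (p : Λ.P) : ℝ≥0∞ :=
  ENNReal.ofReal ((Λ.rhoPow (Λ.deg p))⁻¹ * Λ.pfVector (Λ.s p))

/-- This is the equation A^n x^Λ = ρ(Λ)^n x^Λ, divided by ρ(Λ)^{d(p)+n}. It is the consistency
condition for the measure on cylinder sets. -/
theorem sum_weight [Nonempty Λ.V] (hconn : Λ.StronglyConnected) (hsrc : Λ.NoSources) (p : Λ.P)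
    (n : Fin k → ℕ) : ∑ q ∈ Λ.pathsTo (Λ.s p) n, Λ.weight (Λ.comp p q) = Λ.weight p := by
  have hpf := pfVector_isPerronFrobenius hconn
  have hpos := hpf.rhoPow_pos hsrc
  have h1 : ∀ q ∈ Λ.pathsTo (Λ.s p) n, Λ.weight (Λ.comp p q) =
      ENNReal.ofReal ((Λ.rhoPow (Λ.deg p + n))⁻¹ * Λ.pfVector (Λ.s q)) := by
    intro q hq
    have h2 := mem_pathsTo.1 hq
    rw [weight, Λ.deg_comp _ _ h2.1.symm, Λ.s_comp _ _ h2.1.symm, h2.2]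
  rw [Finset.sum_congr rfl h1, ← ENNReal.ofReal_sum_of_nonneg
    fun q _ => mul_nonneg (inv_nonneg.2 (hpos _).le) (hpf.1 _).le, ← Finset.mul_sum,
    ← pathSum_apply n Λ.pfVector, hpf.pathSum_eq, weight, rhoPow_add, Pi.smul_apply, smul_eq_mul,
    mul_inv, mul_assoc, inv_mul_cancel_left₀ (hpos n).ne']

/-- The fibre of f over p has measure `weight p`, so `sum_weight` allows it to be cut into pieces of
measure `weight (comp p q)` with q ∈ s(p)Λ^d. A point of such a piece receives the longer label pq.
-/
theorem exists_refinement [Nonempty Λ.V] (hconn : Λ.StronglyConnected) (hsrc : Λ.NoSources)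
    (μ : Measure ℝ) (hμ : μ = volume.restrict (Set.Icc 0 1)) (m d : Fin k → ℕ) (f : ℝ → Λ.P)
    (hf : ∀ p, MeasurableSet (f ⁻¹' {p})) (hd : ∀ t, Λ.deg (f t) = m)
    (hw : ∀ p, Λ.deg p = m → μ (f ⁻¹' {p}) = Λ.weight p) :
    ∃ g : ℝ → Λ.P, (∀ p, MeasurableSet (g ⁻¹' {p})) ∧ (∀ t, Λ.deg (g t) = m + d) ∧
      (∀ p, Λ.deg p = m + d → μ (g ⁻¹' {p}) = Λ.weight p) ∧ ∀ t, head (g t) m = f t := by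
  have h1 : ∀ p : Λ.P, ∃ h : ℝ → Λ.P, (∀ q, MeasurableSet (h ⁻¹' {q})) ∧
      (∀ t, h t ∈ Λ.pathsTo (Λ.s p) d) ∧ (Λ.deg p = m → ∀ q ∈ Λ.pathsTo (Λ.s p) d,
        μ (f ⁻¹' {p} ∩ h ⁻¹' {q}) = Λ.weight (Λ.comp p q)) := by
    intro p
    have hne : (Λ.pathsTo (Λ.s p) d).Nonempty := by
      obtain ⟨q, hq⟩ := hsrc (Λ.s p) d
      exact ⟨q, mem_pathsTo.2 hq⟩
    by_cases hp : Λ.deg p = m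
    · obtain ⟨h, h1, h2, h3⟩ := exists_partition_of_sum_eq μ hμ _ hne
        (fun q => Λ.weight (Λ.comp p q)) _ (hf p)
        ((sum_weight hconn hsrc p d).trans (hw p hp).symm)
      exact ⟨h, h1, h2, fun _ => h3⟩
    -- All values of f have degree m, so the fibre over this p is empty and any constant label will
    -- do.
    · obtain ⟨q, hq⟩ := hne
      exact ⟨fun _ => q, fun i => measurableSet_preimage_singleton_of_const _ i, fun _ => hq,
        fun h => absurd h hp⟩
  choose h hmeas hmem hwt using h1
  have hcomp : ∀ t, Λ.s (f t) = Λ.r (h (f t) t) := fun t => (mem_pathsTo.1 (hmem (f t) t)).1.symm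
  have hpre : ∀ p, Λ.deg p = m + d → (fun t => Λ.comp (f t) (h (f t) t)) ⁻¹' {p} =
      f ⁻¹' {head p m} ∩ h (head p m) ⁻¹' {tail p m} := by
    intro p hp
    have hm : m ≤ Λ.deg p := hp ▸ le_self_add
    ext t
    simp only [Set.mem_preimage, Set.mem_singleton_iff, Set.mem_inter_iff]
    constructor
    · intro e
      obtain ⟨e1, e2⟩ := comp_inj (hcomp t) (s_head hm) (by rw [hd, deg_head hm])
        (e.trans (head_comp_tail hm).symm)
      rw [← e1]
      exact ⟨rfl, by rw [e2]⟩
    · rintro ⟨e1, e2⟩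
      rw [e1, e2, head_comp_tail hm]
  have hdeg : ∀ t, Λ.deg (Λ.comp (f t) (h (f t) t)) = m + d := by
    intro t
    rw [Λ.deg_comp _ _ (hcomp t), hd, (mem_pathsTo.1 (hmem (f t) t)).2]
  refine ⟨fun t => Λ.comp (f t) (h (f t) t), fun p => ?_, hdeg, fun p hp => ?_, fun t => ?_⟩
  · by_cases hp : Λ.deg p = m + d
    · rw [hpre p hp]
      exact (hf _).inter (hmeas _ _)
    · convert MeasurableSet.empty
      refine Set.eq_empty_of_forall_notMem fun t ht => hp ?_
      rw [← hdeg t, show Λ.comp (f t) (h (f t) t) = p from ht]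
  · have hm : m ≤ Λ.deg p := hp ▸ le_self_add
    rw [hpre p hp, hwt _ (deg_head hm), head_comp_tail hm]
    refine mem_pathsTo.2 ⟨(s_head hm).symm, ?_⟩
    rw [deg_tail hm, hp, add_tsub_cancel_left]
  · have h2 := head_comp (hcomp t)
    rwa [hd] at h2

theorem exists_initial_partition [Nonempty Λ.V] (hconn : Λ.StronglyConnected)
    (μ : Measure ℝ) (hμ : μ = volume.restrict (Set.Icc 0 1)) :
    ∃ f : ℝ → Λ.P, (∀ p, MeasurableSet (f ⁻¹' {p})) ∧ (∀ t, Λ.deg (f t) = diag k 0) ∧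
      ∀ p, Λ.deg p = diag k 0 → μ (f ⁻¹' {p}) = Λ.weight p := by
  have hpf := pfVector_isPerronFrobenius hconn
  have hid : ∀ p : Λ.P, Λ.deg p = diag k 0 → p = Λ.id (Λ.r p) := fun p => eq_id_of_deg_eq_zero
  have hw : ∀ v, Λ.weight (Λ.id v) = ENNReal.ofReal (Λ.pfVector v) := by
    intro v
    rw [weight, Λ.deg_id, Λ.s_id, rhoPow_zero, inv_one, one_mul]
  obtain ⟨f, h1, -, h3⟩ := exists_partition_of_sum_eq μ hμ (Finset.univ : Finset Λ.V)
    Finset.univ_nonempty (fun v => Λ.weight (Λ.id v)) Set.univ MeasurableSet.univ (by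
      simp only [hw]
      rw [← ENNReal.ofReal_sum_of_nonneg fun v _ => (hpf.1 v).le, hpf.2.1, hμ]
      simp)
  have hpre : ∀ v, (fun t => Λ.id (f t)) ⁻¹' {Λ.id v} = f ⁻¹' {v} := by
    intro v
    ext t
    simp only [Set.mem_preimage, Set.mem_singleton_iff]
    refine ⟨fun e => ?_, fun e => by rw [e]⟩
    rw [← Λ.r_id (f t), e, Λ.r_id]
  refine ⟨fun t => Λ.id (f t), fun p => ?_, fun t => Λ.deg_id _, fun p hp => ?_⟩
  · by_cases hp : Λ.deg p = diag k 0
    · rw [hid p hp, hpre]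
      exact h1 _
    · convert MeasurableSet.empty
      refine Set.eq_empty_of_forall_notMem fun t ht => hp ?_
      rw [← show Λ.id (f t) = p from ht]
      exact Λ.deg_id _
  · rw [hid p hp, hpre, ← h3 _ (Finset.mem_univ _), Set.univ_inter]

/-- Successive refinements label each real number t by a nested sequence of paths of degrees (n, …,
n), hence by an infinite path Φ(t). The preimage under Φ of a diagonal cylinder is a fibre of a
labelling, so the image of Lebesgue measure on [0, 1] has the right values there. Other cylinders
are finite disjoint unions of diagonal ones. -/
theorem exists_isPathMeasure [Nonempty Λ.V] (hconn : Λ.StronglyConnected)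
    (hsrc : Λ.NoSources) : ∃ μ, Λ.IsPathMeasure μ := by
  obtain ⟨μ, hμ⟩ : ∃ μ : Measure ℝ, μ = volume.restrict (Set.Icc 0 1) := ⟨_, rfl⟩
  let Q : ℕ → (ℝ → Λ.P) → Prop := fun n f => (∀ p, MeasurableSet (f ⁻¹' {p})) ∧
    (∀ t, Λ.deg (f t) = diag k n) ∧ ∀ p, Λ.deg p = diag k n → μ (f ⁻¹' {p}) = Λ.weight p
  have hstep : ∀ n (f : {f // Q n f}), ∃ g : {g // Q (n + 1) g},
      ∀ t, head (g.1 t) (diag k n) = f.1 t := by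
    rintro n ⟨f, h1, h2, h3⟩
    -- The sum (n, …, n) + (1, …, 1) is definitionally (n+1, …, n+1).
    obtain ⟨g, h1, h2, h3, h4⟩ := exists_refinement hconn hsrc μ hμ (diag k n) (diag k 1) f h1 h2 h3
    exact ⟨⟨g, h1, h2, h3⟩, h4⟩
  choose next hnext using hstep
  let F : ∀ n, {f // Q n f} := fun n =>
    Nat.rec ⟨_, (exists_initial_partition hconn μ hμ).choose_spec⟩ (fun n f => next n f) n
  have hF : ∀ n t, head ((F (n + 1)).1 t) (diag k n) = (F n).1 t := fun n t => hnext n (F n) t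
  choose Φ hΦ using fun t => exists_infPath (fun n => (F n).1 t) (fun n => (F n).2.2.1 t)
    fun n => hF n t
  have hpre : ∀ (n : ℕ) (p : Λ.P), Λ.deg p = diag k n → Φ ⁻¹' Λ.cylinder p = (F n).1 ⁻¹' {p} := by
    intro n p hp
    ext t
    rw [Set.mem_preimage, mem_cylinder_iff hp, hΦ]
    rfl
  have hmeas : Measurable Φ := by
    refine measurable_of_generateFrom measurableSpace_eq_generateFrom_diagCylinders ?_
    rintro _ (rfl | ⟨n, p, hp, rfl⟩)
    · exact MeasurableSet.empty
    · rw [hpre n p hp]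
      exact (F n).2.1 p
  have hdiag : ∀ (n : ℕ) (p : Λ.P), Λ.deg p = diag k n → μ.map Φ (Λ.cylinder p) = Λ.weight p := by
    intro n p hp
    rw [Measure.map_apply hmeas (measurableSet_cylinder p), hpre n p hp]
    exact (F n).2.2.2 p hp
  refine ⟨μ.map Φ, fun p => ?_⟩
  have hle := le_diag_sum (Λ.deg p)
  rw [cylinder_eq_iUnion p (diag k (∑ i, Λ.deg p i) - Λ.deg p),
    measure_biUnion_finset (pairwiseDisjoint_cylinder_comp _ _)
    fun _ _ => measurableSet_cylinder _, Finset.sum_congr rfl fun q hq =>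
      hdiag _ _ (deg_comp_diag hle hq), sum_weight hconn hsrc]
  rfl

theorem existsUnique_isPathMeasure [Nonempty Λ.V] (hconn : Λ.StronglyConnected)
    (hsrc : Λ.NoSources) : ∃! μ, Λ.IsPathMeasure μ := by
  obtain ⟨μ, hμ⟩ := exists_isPathMeasure hconn hsrc
  exact ⟨μ, hμ, fun ν hν => measure_ext_of_cylinder hν.cylinder_ne_top fun p => by rw [hν p, hμ p]⟩

theorem isPathMeasure_pathMeasure [Nonempty Λ.V] (hconn : Λ.StronglyConnected)
    (hsrc : Λ.NoSources) : Λ.IsPathMeasure Λ.pathMeasure := by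
  have h := exists_isPathMeasure hconn hsrc
  rw [pathMeasure, dif_pos h]
  exact h.choose_spec

end PathMeasure

end KGraph

/-! ### The path representation -/

namespace KGraph

variable {k : ℕ}

section Shift

variable {Λ : KGraph.{u} k}

theorem cylinder_inter_shift_preimage {p q : Λ.P} (h : Λ.s p = Λ.r q) :
    Λ.cylinder p ∩ Λ.shift (Λ.deg p) ⁻¹' Λ.cylinder q = Λ.cylinder (Λ.comp p q) := by
  ext x
  rw [mem_cylinder_comp h]
  rfl

theorem cylinder_inter_shift_preimage_of_ne {p q : Λ.P} (h : Λ.s p ≠ Λ.r q) :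
    Λ.cylinder p ∩ Λ.shift (Λ.deg p) ⁻¹' Λ.cylinder q = ∅ :=
  Set.eq_empty_of_forall_notMem fun _ hx => h (s_eq_r_of_shift_mem hx.1 hx.2)

theorem measurable_shift (n : Fin k → ℕ) : Measurable (Λ.shift n) := by
  refine measurable_of_generateFrom measurableSpace_eq_generateFrom ?_
  rintro _ ⟨q, rfl⟩
  have h1 : Λ.shift n ⁻¹' Λ.cylinder q =
      ⋃ p ∈ {p : Λ.P | Λ.deg p = n ∧ Λ.s p = Λ.r q}, Λ.cylinder (Λ.comp p q) := by
    ext x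
    simp only [Set.mem_iUnion, Set.mem_ofPred_eq, exists_prop, Set.mem_preimage]
    constructor
    · intro hx
      have h2 : x ∈ Λ.cylinder (x.pre n) := mem_cylinder_of_pre rfl
      have hx' : Λ.shift (Λ.deg (x.pre n)) x ∈ Λ.cylinder q := by rwa [x.deg_pre]
      have h3 := s_eq_r_of_shift_mem h2 hx'
      exact ⟨x.pre n, ⟨x.deg_pre n, h3⟩, (mem_cylinder_comp h3).2 ⟨h2, hx'⟩⟩
    · rintro ⟨p, ⟨rfl, h⟩, hx⟩
      exact ((mem_cylinder_comp h).1 hx).2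
  rw [h1]
  exact MeasurableSet.biUnion (Set.to_countable _) fun p _ => measurableSet_cylinder _

theorem cylinder_subset_cylinder_id (p : Λ.P) : Λ.cylinder p ⊆ Λ.cylinder (Λ.id (Λ.r p)) := by
  have h := cylinder_subset_cylinder_head (p := p) (n := 0) zero_le
  rwa [head_zero] at h

theorem chi_comp {p q : Λ.P} (h : Λ.s p = Λ.r q) (x : Λ.InfPath) :
    Λ.chi p x * Λ.chi q (Λ.shift (Λ.deg p) x) = Λ.chi (Λ.comp p q) x := by
  rw [chi, chi, chi, ← cylinder_inter_shift_preimage h]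
  by_cases h1 : x ∈ Λ.cylinder p <;> by_cases h2 : Λ.shift (Λ.deg p) x ∈ Λ.cylinder q <;>
    simp [h1, h2]

theorem chi_mul_chi_of_ne {p q : Λ.P} (h : Λ.s p ≠ Λ.r q) (x : Λ.InfPath) :
    Λ.chi p x * Λ.chi q (Λ.shift (Λ.deg p) x) = 0 := by
  rw [chi, chi]
  by_cases h1 : x ∈ Λ.cylinder p
  · have h2 : Λ.shift (Λ.deg p) x ∉ Λ.cylinder q := fun h2 => h (s_eq_r_of_shift_mem h1 h2)
    simp [h2]
  · simp [h1]

end Shift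

/-! ### The operators on L²(Λ^∞, M) and their Cuntz-Krieger relations -/

section Representation

/-- The standing assumptions on the measure: the values on cylinder sets are the right ones, and
the powers of the spectral radii are positive. -/
class HasPathMeasure (Λ : KGraph.{u} k) [Λ.IsFinite] : Prop where
  isPathMeasure : Λ.IsPathMeasure Λ.pathMeasure
  rhoPow_pos : ∀ n, 0 < Λ.rhoPow n

variable {Λ : KGraph.{u} k} [Λ.IsFinite]

theorem hasPathMeasure [Nonempty Λ.V] (hconn : Λ.StronglyConnected) (hsrc : Λ.NoSources) :
    Λ.HasPathMeasure :=
  ⟨isPathMeasure_pathMeasure hconn hsrc, (pfVector_isPerronFrobenius hconn).rhoPow_pos hsrc⟩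

variable (Λ) in
/-- The scalar `ρ(Λ)^{n/2}`. -/
def sqrtRho (n : Fin k → ℕ) : ℂ := (Real.sqrt (Λ.rhoPow n) : ℂ)

theorem sqrtRho_zero : Λ.sqrtRho 0 = 1 := by
  rw [sqrtRho, rhoPow_zero, Real.sqrt_one, Complex.ofReal_one]

/-- The function `x ↦ χ_[p](x) ρ(Λ)^{d(p)/2} f(σ^{d(p)}(x))`. -/
def opFun (p : Λ.P) (f : Λ.InfPath → ℂ) : Λ.InfPath → ℂ :=
  (Λ.cylinder p).indicator (Λ.sqrtRho (Λ.deg p) • (f ∘ Λ.shift (Λ.deg p)))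

theorem opFun_apply_of_mem {p : Λ.P} {x : Λ.InfPath} (hx : x ∈ Λ.cylinder p)
    (f : Λ.InfPath → ℂ) : opFun p f x = Λ.sqrtRho (Λ.deg p) * f (Λ.shift (Λ.deg p) x) := by
  rw [opFun, Set.indicator_of_mem hx]
  rfl

theorem opFun_apply_of_notMem {p : Λ.P} {x : Λ.InfPath} (hx : x ∉ Λ.cylinder p)
    (f : Λ.InfPath → ℂ) : opFun p f x = 0 := by
  rw [opFun, Set.indicator_of_notMem hx]

theorem opFun_chi (p q : Λ.P) (x : Λ.InfPath) :
    opFun p (Λ.chi q) x =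
      Λ.chi p x * Λ.sqrtRho (Λ.deg p) * Λ.chi q (Λ.shift (Λ.deg p) x) := by
  by_cases hx : x ∈ Λ.cylinder p
  · have h1 : Λ.chi p x = 1 := Set.indicator_of_mem hx _
    rw [opFun_apply_of_mem hx, h1, one_mul]
  · have h1 : Λ.chi p x = 0 := Set.indicator_of_notMem hx _
    rw [opFun_apply_of_notMem hx, h1, zero_mul, zero_mul]

variable [Λ.HasPathMeasure]

theorem rhoPow_pos (n : Fin k → ℕ) : 0 < Λ.rhoPow n := HasPathMeasure.rhoPow_pos n

theorem pathMeasure_cylinder (p : Λ.P) : Λ.pathMeasure (Λ.cylinder p) = Λ.weight p :=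
  HasPathMeasure.isPathMeasure p

theorem pathMeasure_cylinder_ne_top (p : Λ.P) : Λ.pathMeasure (Λ.cylinder p) ≠ ∞ :=
  HasPathMeasure.isPathMeasure.cylinder_ne_top p

instance : IsFiniteMeasure Λ.pathMeasure := ⟨by
  rw [univ_eq_iUnion_cylinder]
  refine (measure_biUnion_finset_le _ _).trans_lt ?_
  exact ENNReal.sum_lt_top.2 fun v _ => (pathMeasure_cylinder_ne_top _).lt_top⟩

theorem weight_comp {p q : Λ.P} (h : Λ.s p = Λ.r q) :
    Λ.weight (Λ.comp p q) = ENNReal.ofReal (Λ.rhoPow (Λ.deg p))⁻¹ * Λ.weight q := by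
  rw [weight, weight, ← ENNReal.ofReal_mul (inv_nonneg.2 (rhoPow_pos _).le), Λ.deg_comp _ _ h,
    Λ.s_comp _ _ h, rhoPow_add, mul_inv, mul_assoc]

/-- The shift by `d(p)` scales the measure on `[p]` by the factor `ρ(Λ)^{-d(p)}`. -/
theorem map_shift_restrict_cylinder (p : Λ.P) :
    (Λ.pathMeasure.restrict (Λ.cylinder p)).map (Λ.shift (Λ.deg p)) =
      ENNReal.ofReal (Λ.rhoPow (Λ.deg p))⁻¹ •
        Λ.pathMeasure.restrict (Λ.cylinder (Λ.id (Λ.s p))) := by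
  refine measure_ext_of_cylinder (fun q => ?_) fun q => ?_
  · rw [Measure.map_apply (measurable_shift _) (measurableSet_cylinder q)]
    exact measure_ne_top _ _
  · rw [Measure.map_apply (measurable_shift _) (measurableSet_cylinder q),
      Measure.restrict_apply (measurable_shift _ (measurableSet_cylinder q)),
      Measure.smul_apply, Measure.restrict_apply (measurableSet_cylinder q), smul_eq_mul,
      Set.inter_comm]
    by_cases h : Λ.s p = Λ.r q
    · rw [cylinder_inter_shift_preimage h, pathMeasure_cylinder, weight_comp h, h,
        Set.inter_eq_left.2 (cylinder_subset_cylinder_id q), pathMeasure_cylinder]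
    · have hd : Disjoint (Λ.cylinder q) (Λ.cylinder (Λ.id (Λ.s p))) :=
        disjoint_cylinder_of_r_ne (by rw [Λ.r_id]; exact fun e => h e.symm)
      rw [cylinder_inter_shift_preimage_of_ne h, hd.inter_eq, measure_empty, mul_zero]

theorem quasiMeasurePreserving_shift (p : Λ.P) :
    Measure.QuasiMeasurePreserving (Λ.shift (Λ.deg p))
      (Λ.pathMeasure.restrict (Λ.cylinder p)) Λ.pathMeasure := by
  refine ⟨measurable_shift _, ?_⟩
  rw [map_shift_restrict_cylinder]
  exact (Measure.smul_absolutelyContinuous).trans Measure.restrict_le_self.absolutelyContinuous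

theorem sqrtRho_ne_zero (n : Fin k → ℕ) : Λ.sqrtRho n ≠ 0 :=
  Complex.ofReal_ne_zero.2 (Real.sqrt_pos.2 (rhoPow_pos n)).ne'

theorem sqrtRho_add (m n : Fin k → ℕ) : Λ.sqrtRho (m + n) = Λ.sqrtRho m * Λ.sqrtRho n := by
  rw [sqrtRho, rhoPow_add, Real.sqrt_mul (rhoPow_pos m).le, Complex.ofReal_mul]
  rfl

theorem opFun_congr_ae (p : Λ.P) {f g : Λ.InfPath → ℂ} (h : f =ᵐ[Λ.pathMeasure] g) :
    opFun p f =ᵐ[Λ.pathMeasure] opFun p g := by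
  have h1 := (quasiMeasurePreserving_shift p).ae_eq_comp h
  filter_upwards [(ae_restrict_iff' (measurableSet_cylinder p)).1 h1] with x hx
  by_cases hxp : x ∈ Λ.cylinder p
  · rw [opFun_apply_of_mem hxp, opFun_apply_of_mem hxp]
    congr 1
    exact hx hxp
  · rw [opFun_apply_of_notMem hxp, opFun_apply_of_notMem hxp]

theorem aestronglyMeasurable_opFun (p : Λ.P) {f : Λ.InfPath → ℂ}
    (hf : AEStronglyMeasurable f Λ.pathMeasure) :
    AEStronglyMeasurable (opFun p f) Λ.pathMeasure := by
  rw [opFun, aestronglyMeasurable_indicator_iff (measurableSet_cylinder p)]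
  exact (hf.comp_quasiMeasurePreserving (quasiMeasurePreserving_shift p)).const_smul _

/-- The factor ρ(Λ)^{d(p)/2} compensates exactly for the scaling of M by ρ(Λ)^{-d(p)} under the
shift. -/
theorem eLpNorm_opFun (p : Λ.P) {f : Λ.InfPath → ℂ}
    (hf : AEStronglyMeasurable f Λ.pathMeasure) :
    eLpNorm (opFun p f) 2 Λ.pathMeasure =
      eLpNorm f 2 (Λ.pathMeasure.restrict (Λ.cylinder (Λ.id (Λ.s p)))) := by
  have hρ := rhoPow_pos (Λ := Λ) (Λ.deg p)
  rw [opFun, eLpNorm_indicator_eq_eLpNorm_restrict (measurableSet_cylinder p), eLpNorm_const_smul,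
    ← eLpNorm_map_measure (hf.mono_ac (quasiMeasurePreserving_shift p).absolutelyContinuous)
      (measurable_shift _).aemeasurable, map_shift_restrict_cylinder,
    eLpNorm_smul_measure_of_ne_top (by simp), smul_eq_mul, ← mul_assoc]
  have h1 : ‖Λ.sqrtRho (Λ.deg p)‖ₑ *
      ENNReal.ofReal (Λ.rhoPow (Λ.deg p))⁻¹ ^ (1 / (2 : ℝ≥0∞)).toReal = 1 := by
    have h2 : (1 / (2 : ℝ≥0∞)).toReal = 1 / 2 := by simp
    rw [h2, ENNReal.ofReal_rpow_of_pos (inv_pos.2 hρ), ← ofReal_norm, sqrtRho, Complex.norm_real,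
      Real.norm_of_nonneg (Real.sqrt_nonneg _), ← ENNReal.ofReal_mul (Real.sqrt_nonneg _),
      ← Real.sqrt_eq_rpow, ← Real.sqrt_mul hρ.le, mul_inv_cancel₀ hρ.ne', Real.sqrt_one,
      ENNReal.ofReal_one]
  rw [h1, one_mul]

theorem memLp_opFun (p : Λ.P) {f : Λ.InfPath → ℂ} (hf : MemLp f 2 Λ.pathMeasure) :
    MemLp (opFun p f) 2 Λ.pathMeasure := by
  refine ⟨aestronglyMeasurable_opFun p hf.1, ?_⟩
  rw [eLpNorm_opFun p hf.1]
  exact (eLpNorm_mono_measure f Measure.restrict_le_self).trans_lt hf.2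

/-- The operator `f ↦ χ_[p] ρ(Λ)^{d(p)/2} (f ∘ σ^{d(p)})` on `L²(Λ^∞, M)`. -/
def pathOp (p : Λ.P) : Λ.L2 →L[ℂ] Λ.L2 :=
  LinearMap.mkContinuous
    { toFun := fun f => (memLp_opFun p (Lp.memLp f)).toLp _
      map_add' := fun f g => by
        rw [← MemLp.toLp_add]
        refine MemLp.toLp_congr _ _ ((opFun_congr_ae p (Lp.coeFn_add f g)).trans (ae_of_all _ ?_))
        intro x
        by_cases hx : x ∈ Λ.cylinder p
        · simp only [Pi.add_apply, opFun_apply_of_mem hx, mul_add]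
        · simp only [Pi.add_apply, opFun_apply_of_notMem hx, add_zero]
      map_smul' := fun c f => by
        rw [RingHom.id_apply, ← MemLp.toLp_const_smul]
        refine MemLp.toLp_congr _ _ ((opFun_congr_ae p (Lp.coeFn_smul c f)).trans (ae_of_all _ ?_))
        intro x
        by_cases hx : x ∈ Λ.cylinder p
        · simp only [Pi.smul_apply, opFun_apply_of_mem hx, smul_eq_mul, mul_left_comm]
        · simp only [Pi.smul_apply, opFun_apply_of_notMem hx, smul_zero] } 1 fun f => by
    rw [one_mul]
    change ‖(memLp_opFun p (Lp.memLp f)).toLp _‖ ≤ ‖f‖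
    rw [Lp.norm_toLp, Lp.norm_def, eLpNorm_opFun p (Lp.memLp f).1]
    exact ENNReal.toReal_mono (Lp.eLpNorm_ne_top f)
      (eLpNorm_mono_measure f Measure.restrict_le_self)

theorem coeFn_pathOp (p : Λ.P) (f : Λ.L2) : pathOp p f =ᵐ[Λ.pathMeasure] opFun p f :=
  MemLp.coeFn_toLp (memLp_opFun p (Lp.memLp f))

/-- Since only s(p) enters the norm, the relation s_p^* s_p = s_{s(p)} will follow by polarization.
-/
theorem norm_pathOp (p : Λ.P) (f : Λ.L2) : ‖pathOp p f‖ = ‖pathOp (Λ.id (Λ.s p)) f‖ := by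
  have h : ∀ q : Λ.P, ‖pathOp q f‖ =
      (eLpNorm f 2 (Λ.pathMeasure.restrict (Λ.cylinder (Λ.id (Λ.s q))))).toReal := by
    intro q
    rw [← eLpNorm_opFun q (Lp.memLp f).1]
    exact Lp.norm_toLp _ (memLp_opFun q (Lp.memLp f))
  rw [h, h, Λ.s_id]

/-- The characteristic function of `[p]` as an element of `L²(Λ^∞, M)`. -/
def chiLp (p : Λ.P) : Λ.L2 :=
  indicatorConstLp 2 (measurableSet_cylinder p) (pathMeasure_cylinder_ne_top p) (1 : ℂ)

theorem coeFn_chiLp (p : Λ.P) : chiLp p =ᵐ[Λ.pathMeasure] Λ.chi p := indicatorConstLp_coeFn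

theorem eq_chiLp_iff {f : Λ.L2} {p : Λ.P} : f =ᵐ[Λ.pathMeasure] Λ.chi p ↔ f = chiLp p :=
  ⟨fun h => Lp.ext (h.trans (coeFn_chiLp p).symm), fun h => h ▸ coeFn_chiLp p⟩

theorem coeFn_pathOp_chiLp (p q : Λ.P) : pathOp p (chiLp q) =ᵐ[Λ.pathMeasure]
    fun x => Λ.chi p x * Λ.sqrtRho (Λ.deg p) * Λ.chi q (Λ.shift (Λ.deg p) x) := by
  filter_upwards [coeFn_pathOp p (chiLp q), opFun_congr_ae p (coeFn_chiLp q)] with x h1 h2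
  rw [h1, h2, opFun_chi]

theorem pathOp_chiLp {p q : Λ.P} (h : Λ.s p = Λ.r q) :
    pathOp p (chiLp q) = Λ.sqrtRho (Λ.deg p) • chiLp (Λ.comp p q) := by
  refine Lp.ext ?_
  filter_upwards [coeFn_pathOp_chiLp p q, Lp.coeFn_smul (Λ.sqrtRho (Λ.deg p)) (chiLp (Λ.comp p q)),
    coeFn_chiLp (Λ.comp p q)] with x h1 h2 h3
  rw [h1, h2, Pi.smul_apply, h3, ← chi_comp h, smul_eq_mul]
  ring

theorem pathOp_chiLp_of_ne {p q : Λ.P} (h : Λ.s p ≠ Λ.r q) : pathOp p (chiLp q) = 0 := by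
  refine Lp.ext ?_
  filter_upwards [coeFn_pathOp_chiLp p q, Lp.coeFn_zero ℂ 2 Λ.pathMeasure] with x h1 h2
  rw [h1, h2, mul_right_comm, chi_mul_chi_of_ne h, zero_mul]
  rfl

theorem inner_chiLp_of_disjoint {p q : Λ.P} (h : Disjoint (Λ.cylinder p) (Λ.cylinder q)) :
    ⟪chiLp p, chiLp q⟫_ℂ = 0 := by
  rw [chiLp, chiLp, L2.inner_indicatorConstLp_one_indicatorConstLp_one, h.inter_eq]
  simp

theorem chiLp_eq_sum (p : Λ.P) (n : Fin k → ℕ) :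
    chiLp p = ∑ q ∈ Λ.pathsTo (Λ.s p) n, chiLp (Λ.comp p q) := by
  refine Lp.ext ?_
  have h : ∀ᵐ x ∂Λ.pathMeasure, ∀ q ∈ Λ.pathsTo (Λ.s p) n,
      chiLp (Λ.comp p q) x = Λ.chi (Λ.comp p q) x :=
    (Finset.eventually_all _).2 fun q _ => coeFn_chiLp _
  filter_upwards [coeFn_chiLp p, h, Lp.coeFn_finsetSum (Λ.pathsTo (Λ.s p) n)
    fun q => (chiLp (Λ.comp p q) : Λ.L2)] with x h1 h2 h3
  rw [h1, h3, Finset.sum_apply, Finset.sum_congr rfl h2, chi, cylinder_eq_iUnion p n,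
    Finset.indicator_biUnion_apply _ _ (pairwiseDisjoint_cylinder_comp p n)]
  rfl

/-- A square integrable function whose integrals over all cylinder sets vanish is zero. -/
theorem eq_zero_of_inner_chiLp {f : Λ.L2} (h : ∀ p, ⟪chiLp p, f⟫_ℂ = 0) : f = 0 := by
  have h1 : ∀ p : Λ.P, ∫ x in Λ.cylinder p, f x ∂Λ.pathMeasure = 0 := by
    intro p
    rw [← L2.inner_indicatorConstLp_one (𝕜 := ℂ) (measurableSet_cylinder p)
      (pathMeasure_cylinder_ne_top p)]
    exact h p
  have hint : Integrable f Λ.pathMeasure := (Lp.memLp f).integrable one_le_two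
  have huniv : ∫ x, f x ∂Λ.pathMeasure = 0 := by
    rw [← setIntegral_univ, univ_eq_iUnion_cylinder,
      integral_biUnion_finset _ (fun v _ => measurableSet_cylinder _) _
        fun v _ => hint.integrableOn]
    · exact Finset.sum_eq_zero fun v _ => h1 _
    · intro v _ w _ hvw
      refine disjoint_cylinder_of_r_ne ?_
      rwa [Λ.r_id, Λ.r_id]
  have h2 : ∀ A : Set Λ.InfPath, MeasurableSet A → ∫ x in A, f x ∂Λ.pathMeasure = 0 := by
    intro A hA
    -- The sets over which f integrates to zero form a Dynkin system; complements are covered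
    -- because the total integral vanishes.
    refine MeasurableSpace.induction_on_inter
      (C := fun A _ => ∫ x in A, f x ∂Λ.pathMeasure = 0)
      measurableSpace_eq_generateFrom_diagCylinders isPiSystem_diagCylinders ?_ ?_ ?_ ?_ A hA
    · simp
    · rintro _ (rfl | ⟨n, p, -, rfl⟩)
      · simp
      · exact h1 p
    · intro A hA ih
      have h3 := integral_add_compl hA hint
      rwa [ih, zero_add, huniv] at h3
    · intro B hd hB ih
      rw [integral_iUnion hB hd hint.integrableOn]
      simp [ih]
  refine Lp.ext ((hint.ae_eq_zero_of_forall_setIntegral_eq_zero fun A hA _ => h2 A hA).trans ?_)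
  exact (Lp.coeFn_zero ℂ 2 Λ.pathMeasure).symm

theorem dense_span_of_chiLp_mem {S : Submodule ℂ Λ.L2} (h : ∀ p, chiLp p ∈ S.topologicalClosure) :
    Dense (S : Set Λ.L2) := by
  rw [Submodule.dense_iff_topologicalClosure_eq_top, Submodule.topologicalClosure_eq_top_iff,
    Submodule.eq_bot_iff]
  intro f hf
  rw [← Submodule.orthogonal_closure] at hf
  exact eq_zero_of_inner_chiLp fun p => hf _ (h p)

theorem dense_span_chiLp : Dense (Submodule.span ℂ (Set.range (chiLp (Λ := Λ))) : Set Λ.L2) :=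
  dense_span_of_chiLp_mem fun p =>
    Submodule.le_topologicalClosure _ (Submodule.subset_span ⟨p, rfl⟩)

/-- The adjoint of `pathOp p` is computed only on χ_[q] with d(p) ≤ d(q), so operator identities
that involve it are tested on long paths. -/
theorem dense_span_chiLp_le (n : Fin k → ℕ) :
    Dense (Submodule.span ℂ (chiLp '' {p : Λ.P | n ≤ Λ.deg p}) : Set Λ.L2) := by
  refine dense_span_of_chiLp_mem fun p => Submodule.le_topologicalClosure _ ?_
  rw [chiLp_eq_sum p n]
  refine Submodule.sum_mem _ fun q hq => Submodule.subset_span ⟨_, ?_, rfl⟩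
  obtain ⟨h1, h2⟩ := mem_pathsTo.1 hq
  rw [Set.mem_ofPred_eq, Λ.deg_comp _ _ h1.symm, h2]
  exact le_add_self

theorem clm_ext_chiLp {S T : Λ.L2 →L[ℂ] Λ.L2} (h : ∀ p, S (chiLp p) = T (chiLp p)) : S = T :=
  ContinuousLinearMap.ext_on dense_span_chiLp (by rintro _ ⟨p, rfl⟩; exact h p)

theorem pathOp_mul {p q : Λ.P} (h : Λ.s p = Λ.r q) :
    pathOp p * pathOp q = pathOp (Λ.comp p q) := by
  refine clm_ext_chiLp fun e => ?_
  rw [mul_apply_eq_comp]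
  by_cases he : Λ.s q = Λ.r e
  · have h1 : Λ.s p = Λ.r (Λ.comp q e) := by rw [Λ.r_comp _ _ he, h]
    rw [pathOp_chiLp he, map_smul, pathOp_chiLp h1, pathOp_chiLp (by rw [Λ.s_comp _ _ h, he]),
      Λ.assoc _ _ _ h he, Λ.deg_comp _ _ h, smul_smul, sqrtRho_add, mul_comm]
  · rw [pathOp_chiLp_of_ne he, map_zero, pathOp_chiLp_of_ne (by rwa [Λ.s_comp _ _ h])]

theorem pathOp_id_chiLp (q : Λ.P) : pathOp (Λ.id (Λ.r q)) (chiLp q) = chiLp q := by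
  rw [pathOp_chiLp (Λ.s_id _), Λ.id_comp, Λ.deg_id, sqrtRho_zero, one_smul]

/-- The operator fixes χ_[q] if r(q) = v and kills it otherwise, and cylinders of paths with
different ranges are disjoint. Symmetry on these functions suffices by density. -/
theorem adjoint_pathOp_id (v : Λ.V) :
    ContinuousLinearMap.adjoint (pathOp (Λ.id v)) = pathOp (Λ.id v) := by
  have key : ∀ p q : Λ.P, ⟪pathOp (Λ.id v) (chiLp p), chiLp q⟫_ℂ =
      ⟪chiLp p, pathOp (Λ.id v) (chiLp q)⟫_ℂ := by
    intro p q
    by_cases hp : v = Λ.r p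
    · by_cases hq : v = Λ.r q
      · conv_lhs => rw [hp, pathOp_id_chiLp]
        conv_rhs => rw [hq, pathOp_id_chiLp]
      · rw [pathOp_chiLp_of_ne (q := q) (by rwa [Λ.s_id]), inner_zero_right, hp, pathOp_id_chiLp,
          inner_chiLp_of_disjoint (disjoint_cylinder_of_r_ne (hp ▸ hq))]
    · by_cases hq : v = Λ.r q
      · rw [pathOp_chiLp_of_ne (by rwa [Λ.s_id]), inner_zero_left, hq, pathOp_id_chiLp,
          inner_chiLp_of_disjoint (disjoint_cylinder_of_r_ne (hq ▸ Ne.symm hp))]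
      · rw [pathOp_chiLp_of_ne (by rwa [Λ.s_id]), pathOp_chiLp_of_ne (by rwa [Λ.s_id]),
          inner_zero_left, inner_zero_right]
  refine clm_ext_chiLp fun q => ?_
  rw [← sub_eq_zero]
  refine eq_zero_of_inner_chiLp fun p => ?_
  rw [inner_sub_right, ContinuousLinearMap.adjoint_inner_right, key, sub_self]

/-- With T_p for `pathOp p`, the quadratic form of T_p^* T_p is ‖T_p f‖², which by `norm_pathOp` is
the form of the projection T_{s(p)}. On a complex Hilbert space the quadratic form determines the
operator. -/
theorem adjoint_pathOp_mul_pathOp (p : Λ.P) :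
    ContinuousLinearMap.adjoint (pathOp p) * pathOp p = pathOp (Λ.id (Λ.s p)) := by
  have hid : pathOp (Λ.id (Λ.s p)) * pathOp (Λ.id (Λ.s p)) = pathOp (Λ.id (Λ.s p)) := by
    have h := Λ.comp_id (Λ.id (Λ.s p))
    rw [Λ.s_id] at h
    rw [pathOp_mul (by rw [Λ.s_id, Λ.r_id]), h]
  have hself : ∀ (q : Λ.P) (f : Λ.L2), ⟪(ContinuousLinearMap.adjoint (pathOp q) * pathOp q) f, f⟫_ℂ
      = ((‖pathOp q f‖ ^ 2 : ℝ) : ℂ) := by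
    intro q f
    rw [mul_apply_eq_comp, ContinuousLinearMap.adjoint_inner_left, inner_self_eq_norm_sq_to_K]
    push_cast
    rfl
  have h1 : ((ContinuousLinearMap.adjoint (pathOp p) * pathOp p -
      ContinuousLinearMap.adjoint (pathOp (Λ.id (Λ.s p))) * pathOp (Λ.id (Λ.s p)) :
        Λ.L2 →L[ℂ] Λ.L2) : Λ.L2 →ₗ[ℂ] Λ.L2) = 0 := by
    rw [← inner_map_self_eq_zero]
    intro f
    rw [ContinuousLinearMap.coe_coe, sub_apply, inner_sub_left, hself, hself, norm_pathOp, sub_self]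
  rw [adjoint_pathOp_id, hid] at h1
  ext1 f
  exact sub_eq_zero.1 (LinearMap.congr_fun h1 f)

theorem adjoint_pathOp_chiLp {p q : Λ.P} (h : Λ.s p = Λ.r q) :
    ContinuousLinearMap.adjoint (pathOp p) (chiLp (Λ.comp p q)) =
      (Λ.sqrtRho (Λ.deg p))⁻¹ • chiLp q := by
  have h1 := congrArg (fun T : Λ.L2 →L[ℂ] Λ.L2 => T (chiLp q)) (adjoint_pathOp_mul_pathOp p)
  rw [mul_apply_eq_comp, pathOp_chiLp h, map_smul, h, pathOp_id_chiLp] at h1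
  rw [← h1, smul_smul, inv_mul_cancel₀ (sqrtRho_ne_zero _), one_smul]

theorem adjoint_pathOp_chiLp_of_ne {p q : Λ.P} (hd : Λ.deg p ≤ Λ.deg q)
    (h : head q (Λ.deg p) ≠ p) : ContinuousLinearMap.adjoint (pathOp p) (chiLp q) = 0 := by
  refine eq_zero_of_inner_chiLp fun e => ?_
  rw [ContinuousLinearMap.adjoint_inner_right]
  by_cases he : Λ.s p = Λ.r e
  · rw [pathOp_chiLp he, inner_smul_left, inner_chiLp_of_disjoint, mul_zero]
    refine disjoint_cylinder (deg_le_deg_comp he) hd ?_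
    rw [head_comp he]
    exact h.symm
  · rw [pathOp_chiLp_of_ne he, inner_zero_left]

variable (Λ) in
/-- The operators `pathOp p` form a Cuntz-Krieger family. -/
def pathFamily : Λ.CKFamily (Λ.L2 →L[ℂ] Λ.L2) where
  t := pathOp
  partial_isometry p := by
    rw [mul_assoc, ContinuousLinearMap.star_eq_adjoint, adjoint_pathOp_mul_pathOp,
      pathOp_mul (Λ.r_id _).symm, Λ.comp_id]
  proj v := by
    refine ⟨?_, ?_⟩
    · have h := Λ.comp_id (Λ.id v)
      rw [Λ.s_id] at h
      rw [IsIdempotentElem, pathOp_mul (by rw [Λ.s_id, Λ.r_id]), h]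
    · rw [IsSelfAdjoint, ContinuousLinearMap.star_eq_adjoint, adjoint_pathOp_id]
  orthogonal v w hvw := by
    refine clm_ext_chiLp fun e => ?_
    rw [mul_apply_eq_comp, zero_apply]
    by_cases he : w = Λ.r e
    · rw [he, pathOp_id_chiLp, pathOp_chiLp_of_ne (by rw [Λ.s_id]; exact he ▸ hvw)]
    · rw [pathOp_chiLp_of_ne (by rwa [Λ.s_id]), map_zero]
  mul p q h := pathOp_mul h
  star_mul_self p := by
    rw [ContinuousLinearMap.star_eq_adjoint, adjoint_pathOp_mul_pathOp]
  sum_mul_star v n := by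
    -- On χ_[e] with n ≤ d(e), only the term of the initial segment of e of degree n survives, and
    -- it returns χ_[e].
    refine ContinuousLinearMap.ext_on (dense_span_chiLp_le n) ?_
    rintro _ ⟨e, he, rfl⟩
    classical
    have hterm : ∀ p ∈ Λ.pathsTo v n, (pathOp p * star (pathOp p)) (chiLp e) =
        if p = head e n then chiLp e else 0 := by
      intro p hp
      have hpn := (mem_pathsTo.1 hp).2
      rw [mul_apply_eq_comp, ContinuousLinearMap.star_eq_adjoint]
      split_ifs with h
      · have h1 : Λ.s p = Λ.r (tail e n) := by rw [h, s_head he]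
        have h2 : chiLp e = chiLp (Λ.comp p (tail e n)) := by rw [h, head_comp_tail he]
        rw [h2, adjoint_pathOp_chiLp h1, map_smul, pathOp_chiLp h1, smul_smul,
          inv_mul_cancel₀ (sqrtRho_ne_zero _), one_smul]
      · rw [adjoint_pathOp_chiLp_of_ne (by rw [hpn]; exact he), map_zero]
        rw [hpn]
        exact fun e => h e.symm
    rw [sum_apply, Finset.sum_congr rfl hterm, Finset.sum_ite_eq']
    by_cases hv : v = Λ.r e
    · rw [if_pos, hv, pathOp_id_chiLp]
      rw [mem_pathsTo, r_head he, deg_head he]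
      exact ⟨hv.symm, rfl⟩
    · rw [if_neg, pathOp_chiLp_of_ne (by rwa [Λ.s_id])]
      rw [mem_pathsTo, r_head he]
      exact fun h => hv h.1.symm

end Representation

end KGraph

/-! ### Diagonal operators on Hilbert spaces -/

section Diagonal

variable {H : Type*} [NormedAddCommGroup H] [InnerProductSpace ℂ H]

theorem le_of_sq_le_sq_of_nonneg {a b : ℝ} (h : a ^ 2 ≤ b ^ 2) (hb : 0 ≤ b) : a ≤ b :=
  (le_abs_self a).trans (abs_le_of_sq_le_sq h hb)

theorem summable_iff_of_pairwise_orthogonal [CompleteSpace H] {g : ℕ → H}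
    (h : Pairwise fun i j => ⟪g i, g j⟫_ℂ = 0) : Summable g ↔ Summable fun i => ‖g i‖ ^ 2 := by
  have hV : OrthogonalFamily ℂ (fun i => Submodule.span ℂ {g i})
      (fun i => (Submodule.span ℂ {g i}).subtypeₗᵢ) := by
    intro i j hij v w
    obtain ⟨a, ha⟩ := Submodule.mem_span_singleton.1 v.2
    obtain ⟨b, hb⟩ := Submodule.mem_span_singleton.1 w.2
    change ⟪(v : H), (w : H)⟫_ℂ = 0
    rw [← ha, ← hb, inner_smul_left,
      inner_smul_right, h hij, mul_zero, mul_zero]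
  exact hV.summable_iff_norm_sq_summable fun i => ⟨g i, Submodule.mem_span_singleton_self _⟩

/-- A sequence of mutually orthogonal projections with (strong) sum one. -/
structure IsProjectionResolution (P : ℕ → H →L[ℂ] H) : Prop where
  inner_left : ∀ q f g, ⟪P q f, g⟫_ℂ = ⟪f, P q g⟫_ℂ
  apply_self : ∀ q f, P q (P q f) = P q f
  apply_of_ne : ∀ q q', q ≠ q' → ∀ f, P q (P q' f) = 0
  hasSum : ∀ f, HasSum (fun q => P q f) f

namespace IsProjectionResolution

variable {P : ℕ → H →L[ℂ] H}

theorem orthogonal (hP : IsProjectionResolution P) {q q' : ℕ} (h : q ≠ q') (f g : H) :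
    ⟪P q f, P q' g⟫_ℂ = 0 := by
  rw [hP.inner_left, hP.apply_of_ne q q' h, inner_zero_right]

theorem summable_iff [CompleteSpace H] (hP : IsProjectionResolution P) {g : ℕ → H}
    (hg : ∀ q, P q (g q) = g q) : Summable g ↔ Summable fun q => ‖g q‖ ^ 2 := by
  refine summable_iff_of_pairwise_orthogonal fun i j hij => ?_
  dsimp only
  rw [← hg i, ← hg j]
  exact hP.orthogonal hij _ _

theorem apply_tsum (hP : IsProjectionResolution P) {g : ℕ → H} (hg : ∀ q, P q (g q) = g q)
    (hs : Summable g) (q : ℕ) : P q (∑' i, g i) = g q := by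
  rw [(P q).map_tsum hs, tsum_eq_single q, hg]
  intro i hi
  rw [← hg i, hP.apply_of_ne q i hi.symm]

theorem ext (hP : IsProjectionResolution P) {f g : H} (h : ∀ q, P q f = P q g) : f = g := by
  have h1 := hP.hasSum f
  simp only [h] at h1
  exact h1.unique (hP.hasSum g)

theorem hasSum_norm_sq (hP : IsProjectionResolution P) (f : H) :
    HasSum (fun q => ‖P q f‖ ^ 2) (‖f‖ ^ 2) := by
  have h1 := ((hP.hasSum f).mapL (innerSL ℂ f)).mapL Complex.reCLM
  have h2 : ∀ q, Complex.reCLM (innerSL ℂ f (P q f)) = ‖P q f‖ ^ 2 := by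
    intro q
    rw [innerSL_apply_apply, ← hP.apply_self, ← hP.inner_left, hP.apply_self]
    exact (norm_sq_eq_re_inner (𝕜 := ℂ) _).symm
  simp only [h2] at h1
  rw [norm_sq_eq_re_inner (𝕜 := ℂ) f]
  exact h1

theorem norm_apply_le (hP : IsProjectionResolution P) (q : ℕ) (f : H) : ‖P q f‖ ≤ ‖f‖ :=
  le_of_sq_le_sq_of_nonneg (le_hasSum (hP.hasSum_norm_sq f) q fun _ _ => sq_nonneg _)
    (norm_nonneg f)

theorem norm_sum_smul_sq_le (hP : IsProjectionResolution P) (s : Finset ℕ) (b : ℕ → ℝ) {C : ℝ}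
    (hb : ∀ q ∈ s, |b q| ≤ C) (f : H) :
    ‖∑ q ∈ s, (b q : ℂ) • P q f‖ ^ 2 ≤ C ^ 2 * ∑ q ∈ s, ‖P q f‖ ^ 2 := by
  have h1 : ∀ q, P q (∑ i ∈ s, (b i : ℂ) • P i f) = if q ∈ s then (b q : ℂ) • P q f else 0 := by
    intro q
    rw [map_sum, ← Finset.sum_ite_eq s q fun q => (b q : ℂ) • P q f]
    refine Finset.sum_congr rfl fun i _ => ?_
    rw [map_smul]
    split_ifs with h
    · rw [← h, hP.apply_self]
    · rw [hP.apply_of_ne _ _ h, smul_zero]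
  have h2 := hP.hasSum_norm_sq (∑ i ∈ s, (b i : ℂ) • P i f)
  have h3 := h2.unique (hasSum_sum_of_ne_finset_zero (s := s) fun q hq => by
    rw [h1, if_neg hq, norm_zero, zero_pow two_ne_zero])
  rw [h3, Finset.mul_sum]
  refine Finset.sum_le_sum fun q hq => ?_
  rw [h1, if_pos hq, norm_smul, mul_pow, Complex.norm_real, Real.norm_eq_abs]
  exact mul_le_mul_of_nonneg_right (pow_le_pow_left₀ (abs_nonneg _) (hb q hq) 2) (sq_nonneg _)

/-- An operator can be prescribed through its components. -/
theorem exists_operator [CompleteSpace H] (hP : IsProjectionResolution P) (K : ℕ → H →L[ℂ] H)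
    (hK : ∀ q f, P q (K q f) = K q f) {C : ℝ} (hC0 : 0 ≤ C)
    (hC : ∀ f N, ∑ q ∈ Finset.range N, ‖K q f‖ ^ 2 ≤ C ^ 2 * ‖f‖ ^ 2) :
    ∃ T : H →L[ℂ] H, (∀ q f, P q (T f) = K q f) ∧ ‖T‖ ≤ C := by
  have hs2 : ∀ f, Summable fun q => ‖K q f‖ ^ 2 := fun f =>
    summable_of_sum_range_le (fun _ => sq_nonneg _) (hC f)
  have hs : ∀ f, Summable fun q => K q f := fun f => (hP.summable_iff fun q => hK q f).2 (hs2 f)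
  have hT : ∀ q f, P q (∑' i, K i f) = K q f := fun q f => hP.apply_tsum (fun q => hK q f) (hs f) q
  let L : H →ₗ[ℂ] H :=
    { toFun := fun f => ∑' q, K q f
      map_add' := fun f g => by
        rw [← (hs f).tsum_add (hs g)]
        simp only [map_add]
      map_smul' := fun c f => by
        rw [RingHom.id_apply, ← (hs f).tsum_const_smul]
        simp only [map_smul] }
  have hbd : ∀ f, ‖L f‖ ≤ C * ‖f‖ := by
    intro f
    refine le_of_sq_le_sq_of_nonneg ?_ (mul_nonneg hC0 (norm_nonneg f))
    rw [← (hP.hasSum_norm_sq (L f)).tsum_eq, mul_pow]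
    refine Real.tsum_le_of_sum_range_le (fun _ => sq_nonneg _) fun N => ?_
    refine le_trans (le_of_eq ?_) (hC f N)
    exact Finset.sum_congr rfl fun q _ => by rw [show P q (L f) = K q f from hT q f]
  exact ⟨L.mkContinuous C hbd, hT, L.mkContinuous_norm_le hC0 hbd⟩

/-- Bounded sequences define bounded diagonal operators. -/
theorem exists_diagonal_operator [CompleteSpace H] (hP : IsProjectionResolution P) (b : ℕ → ℝ)
    {C : ℝ} (hb : ∀ q, |b q| ≤ C) : ∃ T : H →L[ℂ] H, (∀ q f, P q (T f) = (b q : ℂ) • P q f) ∧ ‖T‖ ≤ C := by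
  have hC0 : 0 ≤ C := (abs_nonneg _).trans (hb 0)
  refine hP.exists_operator (fun q => (b q : ℂ) • P q) (fun q f => ?_) hC0 fun f N => ?_
  · simp [hP.apply_self]
  · calc ∑ q ∈ Finset.range N, ‖((b q : ℂ) • P q) f‖ ^ 2
        ≤ ∑ q ∈ Finset.range N, C ^ 2 * ‖P q f‖ ^ 2 := by
          refine Finset.sum_le_sum fun q _ => ?_
          rw [smul_apply, norm_smul, mul_pow, Complex.norm_real, Real.norm_eq_abs]
          exact mul_le_mul_of_nonneg_right (pow_le_pow_left₀ (abs_nonneg _) (hb q) 2) (sq_nonneg _)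
      _ ≤ C ^ 2 * ‖f‖ ^ 2 := by
          rw [← Finset.mul_sum]
          exact mul_le_mul_of_nonneg_left
            (sum_le_hasSum _ (fun _ _ => sq_nonneg _) (hP.hasSum_norm_sq f)) (sq_nonneg C)

end IsProjectionResolution

/-- `D` is the diagonal operator with eigenvalue `β q` on the range of `P q`, with its maximal
domain. -/
def IsDiagonalOperator (P : ℕ → H →L[ℂ] H) (β : ℕ → ℝ) (D : H →ₗ.[ℂ] H) : Prop :=
  ∀ f y, (∃ h : f ∈ D.domain, D ⟨f, h⟩ = y) ↔ ∀ q, P q y = (β q : ℂ) • P q f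

namespace IsDiagonalOperator

variable {P : ℕ → H →L[ℂ] H} {β : ℕ → ℝ} {D : H →ₗ.[ℂ] H}

theorem proj_apply (hD : IsDiagonalOperator P β D) (f : D.domain) (q : ℕ) :
    P q (D f) = (β q : ℂ) • P q f :=
  (hD f (D f)).1 ⟨f.2, rfl⟩ q

theorem proj_mem_domain (hP : IsProjectionResolution P) (hD : IsDiagonalOperator P β D) (q : ℕ)
    (f : H) : ∃ h : P q f ∈ D.domain, D ⟨P q f, h⟩ = (β q : ℂ) • P q f := by
  refine (hD _ _).2 fun q' => ?_
  rw [map_smul]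
  by_cases h : q' = q
  · rw [h]
  · rw [hP.apply_of_ne _ _ h, smul_zero, smul_zero]

theorem dense_domain (hP : IsProjectionResolution P) (hD : IsDiagonalOperator P β D) :
    Dense (D.domain : Set H) := by
  intro f
  exact mem_closure_of_tendsto (hP.hasSum f) (Eventually.of_forall fun s =>
    D.domain.sum_mem fun q _ => (proj_mem_domain hP hD q f).1)

/-- Pairing D^* y with vectors P_q g gives P_q D^* y = β_q P_q y, and maximality of the domain puts
y into the domain of D. The other inclusion is symmetry of D, which holds term by term because the
β_q are real. -/
theorem isSelfAdjoint [CompleteSpace H] (hP : IsProjectionResolution P)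
    (hD : IsDiagonalOperator P β D) :
    IsSelfAdjoint D := by
  have hdense := dense_domain hP hD
  rw [LinearPMap.isSelfAdjoint_def]
  apply le_antisymm
  · have key : ∀ y : D.adjoint.domain, ∀ q, P q (D.adjoint y) = (β q : ℂ) • P q y := by
      intro y q
      refine ext_inner_right ℂ fun g => ?_
      obtain ⟨h1, h2⟩ := proj_mem_domain hP hD q g
      have h3 := LinearPMap.adjoint_isFormalAdjoint hdense y ⟨P q g, h1⟩
      rw [h2] at h3
      rw [hP.inner_left, h3, inner_smul_right, inner_smul_left, hP.inner_left, Complex.conj_ofReal]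
    refine ⟨fun y hy => ((hD y _).2 (key ⟨y, hy⟩)).1, fun x y hxy => ?_⟩
    obtain ⟨h1, h2⟩ := (hD x _).2 (key x)
    rw [← h2]
    congr 1
    exact Subtype.ext hxy
  · refine LinearPMap.IsFormalAdjoint.le_adjoint hdense fun x y => ?_
    have h1 := (hP.hasSum (D x)).mapL ((innerSL ℂ).flip (y : H))
    have h2 := (hP.hasSum (D y)).mapL (innerSL ℂ (x : H))
    have h3 : ∀ q, ((innerSL ℂ).flip (y : H)) (P q (D x)) = innerSL ℂ (x : H) (P q (D y)) := by
      intro q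
      rw [proj_apply hD, proj_apply hD]
      change ⟪(β q : ℂ) • P q x, (y : H)⟫_ℂ = ⟪(x : H), (β q : ℂ) • P q y⟫_ℂ
      rw [inner_smul_left, inner_smul_right, hP.inner_left, Complex.conj_ofReal]
    simp only [h3] at h1
    exact h1.unique h2

/-- The inverse R has eigenvalues (β_q² + 1)⁻¹. These tend to zero, so R is a norm limit of finite
sums of compact operators. The auxiliary operator Q, with eigenvalues β_q (β_q² + 1)⁻¹, is D R; it
shows that R g lies in the domain of D² because D Q g = g - R g. -/
theorem hasCompactResolvent [CompleteSpace H] (hP : IsProjectionResolution P)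
    (hD : IsDiagonalOperator P β D) (hcpt : ∀ q, IsCompactOperator (P q)) (hβ : Tendsto β atTop atTop) :
    HasCompactResolvent D := by
  have hpos : ∀ q, 0 < β q ^ 2 + 1 := fun q => by positivity
  have hposC : ∀ q, ((β q : ℂ) ^ 2 + 1) ≠ 0 := fun q => by
    exact_mod_cast (hpos q).ne'
  have hc1 : ∀ q, |(β q ^ 2 + 1)⁻¹| ≤ 1 := fun q => by
    rw [abs_of_pos (inv_pos.2 (hpos q))]
    exact inv_le_one_of_one_le₀ (by nlinarith [sq_nonneg (β q)])
  obtain ⟨R, hR, -⟩ := hP.exists_diagonal_operator (fun q => (β q ^ 2 + 1)⁻¹) hc1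
  obtain ⟨Q, hQ, -⟩ := hP.exists_diagonal_operator (C := 1) (fun q => β q * (β q ^ 2 + 1)⁻¹)
    fun q => by
      rw [abs_mul, abs_of_pos (inv_pos.2 (hpos q)), ← div_eq_mul_inv, div_le_one (hpos q)]
      rcases abs_cases (β q) with h | h <;> nlinarith [sq_nonneg (|β q| - 1), sq_abs (β q)]
  refine ⟨R, ?_, fun f g => ⟨?_, ?_⟩⟩
  · have htail : ∀ ε > 0, ∃ N : ℕ, ∀ q ≥ N, (β q ^ 2 + 1)⁻¹ ≤ ε := by
      intro ε hε
      have h1 : Tendsto (fun q => (β q ^ 2 + 1)⁻¹) atTop (𝓝 0) :=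
        (tendsto_atTop_add_const_right _ _
          ((tendsto_pow_atTop two_ne_zero).comp hβ)).inv_tendsto_atTop
      obtain ⟨N, hN⟩ := eventually_atTop.1 (h1.eventually_le_const hε)
      exact ⟨N, hN⟩
    have hlim : Tendsto (fun N => ∑ q ∈ Finset.range N, ((β q ^ 2 + 1)⁻¹ : ℂ) • P q) atTop
        (𝓝 R) := by
      rw [Metric.tendsto_atTop]
      intro ε hε
      obtain ⟨N, hN⟩ := htail (ε / 2) (half_pos hε)
      refine ⟨N, fun n hn => ?_⟩
      -- S is the tail of R: its eigenvalues vanish below n and are at most ε/2 from n on.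
      obtain ⟨S, hS, hSn⟩ := hP.exists_diagonal_operator (C := ε / 2)
        (fun q => if q < n then 0 else (β q ^ 2 + 1)⁻¹) fun q => by
          split_ifs with h
          · simpa using (half_pos hε).le
          · rw [abs_of_pos (inv_pos.2 (hpos q))]
            exact hN q (hn.trans (not_lt.1 h))
      have hRS : R - ∑ q ∈ Finset.range n, ((β q ^ 2 + 1)⁻¹ : ℂ) • P q = S := by
        ext1 f
        refine hP.ext fun q => ?_
        rw [hS, sub_apply, map_sub, hR, sum_apply, map_sum]
        have hterm : ∀ i ∈ Finset.range n, P q ((((β i : ℂ) ^ 2 + 1)⁻¹ • P i) f) =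
            if q = i then ((β q : ℂ) ^ 2 + 1)⁻¹ • P q f else 0 := by
          intro i _
          rw [smul_apply, map_smul]
          split_ifs with h
          · rw [h, hP.apply_self]
          · rw [hP.apply_of_ne _ _ h, smul_zero]
        rw [Finset.sum_congr rfl hterm, Finset.sum_ite_eq]
        by_cases h : q < n
        · simp [h]
        · simp [h]
      rw [dist_comm, dist_eq_norm, hRS]
      linarith
    refine isCompactOperator_of_tendsto hlim (Eventually.of_forall fun N => ?_)
    have : ∀ s : Finset ℕ,
        IsCompactOperator (∑ q ∈ s, ((β q ^ 2 + 1)⁻¹ : ℂ) • P q : H →L[ℂ] H) := by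
      intro s
      have hmem : ∑ q ∈ s, ((β q ^ 2 + 1)⁻¹ : ℂ) • P q ∈ compactOperator (RingHom.id ℂ) H H :=
        Submodule.sum_mem _ fun q _ => Submodule.smul_mem _ _ (hcpt q)
      exact hmem
    exact this _
  · rintro rfl
    obtain ⟨h1, h2⟩ := (hD (R g) (Q g)).2 fun q => by
      rw [hR, hQ, smul_smul]
      push_cast
      rfl
    obtain ⟨h3, h4⟩ := (hD (Q g) (g - R g)).2 fun q => by
      rw [map_sub, hR, hQ, smul_smul]
      nth_rewrite 1 [← one_smul ℂ (P q g)]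
      rw [← sub_smul]
      congr 1
      push_cast
      field_simp [hposC q]
      ring
    refine ⟨h1, ?_⟩
    rw [h2]
    exact ⟨h3, by rw [h4, sub_add_cancel]⟩
  · rintro ⟨h1, h2, h3⟩
    refine hP.ext fun q => ?_
    rw [hR, ← h3, map_add, proj_apply hD ⟨_, h2⟩, proj_apply hD ⟨f, h1⟩]
    have h4 : ((β q : ℂ) • (β q : ℂ) • P q f + P q f) = ((β q : ℂ) ^ 2 + 1) • P q f := by
      rw [smul_smul, add_smul, one_smul, sq]
    push_cast
    rw [h4, smul_smul, inv_mul_cancel₀ (hposC q), one_smul]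

end IsDiagonalOperator

end Diagonal

/-! ### Operators of finite band width for a filtration -/

section Banded

variable {H : Type*} [NormedAddCommGroup H] [InnerProductSpace ℂ H] [CompleteSpace H]
  {V : ℕ → Submodule ℂ H}

/-- `T` and its adjoint raise the filtration degree by at most `c`. -/
def IsBanded (V : ℕ → Submodule ℂ H) (c : ℕ) (T : H →L[ℂ] H) : Prop :=
  ∀ q, ∀ f ∈ V q, T f ∈ V (q + c) ∧ ContinuousLinearMap.adjoint T f ∈ V (q + c)

theorem IsBanded.mono (hV : Monotone V) {c d : ℕ} (h : c ≤ d) {T : H →L[ℂ] H}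
    (hT : IsBanded V c T) : IsBanded V d T := fun q f hf =>
  ⟨hV (Nat.add_le_add_left h q) (hT q f hf).1, hV (Nat.add_le_add_left h q) (hT q f hf).2⟩

theorem IsBanded.add {c : ℕ} {S T : H →L[ℂ] H} (hS : IsBanded V c S) (hT : IsBanded V c T) :
    IsBanded V c (S + T) := fun q f hf => by
  rw [map_add]
  exact ⟨add_mem (hS q f hf).1 (hT q f hf).1, add_mem (hS q f hf).2 (hT q f hf).2⟩

theorem IsBanded.smul {c : ℕ} {T : H →L[ℂ] H} (hT : IsBanded V c T) (z : ℂ) :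
    IsBanded V c (z • T) := fun q f hf => by
  rw [map_smulₛₗ]
  exact ⟨Submodule.smul_mem _ _ (hT q f hf).1, Submodule.smul_mem _ _ (hT q f hf).2⟩

theorem IsBanded.zero (c : ℕ) : IsBanded V c 0 := fun q f _ => by
  rw [map_zero]
  exact ⟨zero_mem _, zero_mem _⟩

theorem IsBanded.star {c : ℕ} {T : H →L[ℂ] H} (hT : IsBanded V c T) :
    IsBanded V c (star T) := fun q f hf => by
  rw [ContinuousLinearMap.star_eq_adjoint, ContinuousLinearMap.adjoint_adjoint]
  exact ⟨(hT q f hf).2, (hT q f hf).1⟩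

theorem IsBanded.mul {c d : ℕ} {S T : H →L[ℂ] H} (hS : IsBanded V c S) (hT : IsBanded V d T) :
    IsBanded V (c + d) (S * T) := fun q f hf => by
  have h1 := (hS _ _ (hT q f hf).1).1
  have h2 := (hT _ _ (hS q f hf).2).2
  rw [← ContinuousLinearMap.star_eq_adjoint, star_mul]
  rw [add_right_comm, add_assoc] at h1
  rw [add_assoc] at h2
  exact ⟨h1, h2⟩

end Banded

/-! ### Increments of an increasing sequence of projections, and commutators -/

section Filtration

variable {H : Type*} [NormedAddCommGroup H] [InnerProductSpace ℂ H]

/-- The successive differences of the orthogonal projections onto a sequence of subspaces. -/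
def incrementProj (V : ℕ → Submodule ℂ H) [∀ q, FiniteDimensional ℂ (V q)] : ℕ → H →L[ℂ] H
  | 0 => (V 0).starProjection
  | q + 1 => (V (q + 1)).starProjection - (V q).starProjection

variable {V : ℕ → Submodule ℂ H} [∀ q, FiniteDimensional ℂ (V q)]

theorem sum_incrementProj (n : ℕ) :
    ∑ q ∈ Finset.range (n + 1), incrementProj V q = (V n).starProjection := by
  induction n with
  | zero => simp [incrementProj]
  | succ n ih =>
    rw [Finset.sum_range_succ, ih, incrementProj]
    abel

theorem starProjection_apply_of_mem {U : Submodule ℂ H} [U.HasOrthogonalProjection] {f : H}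
    (h : f ∈ U) : U.starProjection f = f :=
  Submodule.starProjection_eq_self_iff.2 h

theorem incrementProj_mem (hV : Monotone V) (q : ℕ) (f : H) : incrementProj V q f ∈ V q := by
  cases q with
  | zero => exact Submodule.starProjection_apply_mem _ _
  | succ q =>
    exact Submodule.sub_mem _ (Submodule.starProjection_apply_mem _ _)
      (hV q.le_succ (Submodule.starProjection_apply_mem _ _))

theorem incrementProj_apply_of_mem (hV : Monotone V) {m q : ℕ} (h : m < q) {f : H} (hf : f ∈ V m) :
    incrementProj V q f = 0 := by
  cases q with
  | zero => exact absurd h (Nat.not_lt_zero _)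
  | succ q =>
    rw [incrementProj, sub_apply, starProjection_apply_of_mem (hV h.le hf),
      starProjection_apply_of_mem (hV (Nat.le_of_lt_succ h) hf), sub_self]

theorem inner_incrementProj_left (q : ℕ) (f g : H) :
    ⟪incrementProj V q f, g⟫_ℂ = ⟪f, incrementProj V q g⟫_ℂ := by
  cases q with
  | zero => exact Submodule.inner_starProjection_left_eq_right _ _ _
  | succ q =>
    rw [incrementProj, sub_apply, sub_apply, inner_sub_left, inner_sub_right,
      Submodule.inner_starProjection_left_eq_right, Submodule.inner_starProjection_left_eq_right]

theorem incrementProj_incrementProj_of_ne (hV : Monotone V) {m n : ℕ} (h : m ≠ n) (f : H) :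
    incrementProj V m (incrementProj V n f) = 0 := by
  rcases lt_or_gt_of_ne h with h | h
  · refine ext_inner_right ℂ fun g => ?_
    rw [inner_incrementProj_left, inner_incrementProj_left,
      incrementProj_apply_of_mem hV h (incrementProj_mem hV m g), inner_zero_right, inner_zero_left]
  · exact incrementProj_apply_of_mem hV h (incrementProj_mem hV n f)

theorem incrementProj_incrementProj_self (hV : Monotone V) (q : ℕ) (f : H) :
    incrementProj V q (incrementProj V q f) = incrementProj V q f := by
  have h1 := congrArg (fun T : H →L[ℂ] H => T (incrementProj V q f)) (sum_incrementProj (V := V) q)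
  rw [sum_apply, Finset.sum_eq_single q, starProjection_apply_of_mem (incrementProj_mem hV q f)]
    at h1
  · exact h1
  · intro i _ hi
    exact incrementProj_incrementProj_of_ne hV hi f
  · intro hq
    exact absurd (Finset.self_mem_range_succ q) hq

/-- The partial sums are the projections onto the V n and converge strongly to the identity by
density. The sum must also converge unconditionally. By orthogonality this needs only a bound for
the sums of ‖P_q f‖², which equal Re ⟪Ξ f, f⟫ for the projection Ξ onto some V n and hence are at
most ‖f‖². -/
theorem isProjectionResolution_incrementProj [CompleteSpace H] (hV : Monotone V)
    (hdense : (⨆ q, V q).topologicalClosure = ⊤) :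
    IsProjectionResolution (incrementProj V) where
  inner_left := inner_incrementProj_left
  apply_self := incrementProj_incrementProj_self hV
  apply_of_ne q q' h f := incrementProj_incrementProj_of_ne hV h f
  hasSum f := by
    have horth : Pairwise fun i j => ⟪incrementProj V i f, incrementProj V j f⟫_ℂ = 0 := by
      intro i j hij
      rw [inner_incrementProj_left, incrementProj_incrementProj_of_ne hV hij, inner_zero_right]
    have hlim := Submodule.starProjection_tendsto_self V hV f hdense.ge
    have hsum : ∀ n, ∑ q ∈ Finset.range (n + 1), incrementProj V q f = (V n).starProjection f := by
      intro n
      rw [← sum_apply, sum_incrementProj]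
    have hs : Summable fun q => incrementProj V q f := by
      rw [summable_iff_of_pairwise_orthogonal horth]
      refine summable_of_sum_range_le (c := ‖f‖ ^ 2) (fun _ => sq_nonneg _) fun n => ?_
      refine (Finset.sum_le_sum_of_subset_of_nonneg (Finset.range_mono n.le_succ)
        fun _ _ _ => sq_nonneg _).trans ?_
      have h1 : ∀ q, ‖incrementProj V q f‖ ^ 2 = RCLike.re ⟪incrementProj V q f, f⟫_ℂ := by
        intro q
        rw [@norm_sq_eq_re_inner ℂ, inner_incrementProj_left, incrementProj_incrementProj_self hV,
          ← inner_incrementProj_left]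
      rw [Finset.sum_congr rfl fun q _ => h1 q, ← map_sum, ← sum_inner, hsum]
      refine (re_inner_le_norm _ _).trans ?_
      rw [sq]
      exact mul_le_mul_of_nonneg_right (Submodule.norm_starProjection_apply_le _ _) (norm_nonneg _)
    have h2 := (tendsto_add_atTop_iff_nat 1).2 hs.hasSum.tendsto_sum_nat
    simp only [hsum] at h2
    have h3 := hs.hasSum
    rwa [tendsto_nhds_unique h2 hlim] at h3

theorem isCompactOperator_starProjection (U : Submodule ℂ H) [FiniteDimensional ℂ U] :
    IsCompactOperator U.starProjection := by
  have h1 : IsCompactOperator U.orthogonalProjectionOnto := by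
    have : ProperSpace U := FiniteDimensional.proper ℂ U
    exact isCompactOperator_of_locallyCompactSpace_dom U.orthogonalProjectionOnto
  exact h1.clm_comp U.subtypeL

theorem isCompactOperator_incrementProj (q : ℕ) : IsCompactOperator (incrementProj V q) := by
  cases q with
  | zero => exact isCompactOperator_starProjection _
  | succ q => exact (isCompactOperator_starProjection _).sub (isCompactOperator_starProjection _)

variable [CompleteSpace H]

/-- Blocks with p > q + c vanish because T raises the level by at most c; those with q > p + c
vanish because the adjoint does. -/
theorem IsBanded.incrementProj_eq_zero (hV : Monotone V) {c : ℕ} {T : H →L[ℂ] H}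
    (hT : IsBanded V c T) {p q : ℕ} (h : q ∉ Finset.Icc (p - c) (p + c)) (f : H) :
    incrementProj V p (T (incrementProj V q f)) = 0 := by
  rw [Finset.mem_Icc] at h
  rcases lt_or_ge (q + c) p with h1 | h1
  · exact incrementProj_apply_of_mem hV h1 (hT q _ (incrementProj_mem hV q f)).1
  · refine ext_inner_right ℂ fun g => ?_
    rw [inner_incrementProj_left, ← ContinuousLinearMap.adjoint_inner_right,
      inner_incrementProj_left, incrementProj_apply_of_mem hV (m := p + c) (by omega)
        (hT p _ (incrementProj_mem hV p g)).2, inner_zero_right, inner_zero_left]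

theorem abs_sub_le_of_lipschitz {β : ℕ → ℝ} {C : ℝ} (hβ : ∀ q, |β (q + 1) - β q| ≤ C) (m j : ℕ) :
    |β (m + j) - β m| ≤ C * j := by
  induction j with
  | zero => simp
  | succ j ih =>
    have h1 := abs_sub_le (β (m + (j + 1))) (β (m + j)) (β m)
    have h2 := hβ (m + j)
    rw [add_assoc] at h2
    push_cast
    linarith

theorem abs_sub_le_of_mem_Icc {β : ℕ → ℝ} {C : ℝ} (hβ : ∀ q, |β (q + 1) - β q| ≤ C) {c p q : ℕ}
    (h : q ∈ Finset.Icc (p - c) (p + c)) : |β p - β q| ≤ C * c := by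
  rw [Finset.mem_Icc] at h
  have hC : 0 ≤ C := (abs_nonneg _).trans (hβ 0)
  rcases le_total p q with h1 | h1
  · obtain ⟨j, rfl⟩ := Nat.exists_eq_add_of_le h1
    rw [abs_sub_comm]
    refine (abs_sub_le_of_lipschitz hβ p j).trans (mul_le_mul_of_nonneg_left ?_ hC)
    exact_mod_cast (by omega : j ≤ c)
  · obtain ⟨j, rfl⟩ := Nat.exists_eq_add_of_le h1
    refine (abs_sub_le_of_lipschitz hβ q j).trans (mul_le_mul_of_nonneg_left ?_ hC)
    exact_mod_cast (by omega : j ≤ c)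

/-- After exchanging the sums, each q occurs in at most 2c + 1 of the windows [p - c, p + c]. -/
theorem sum_range_sum_Icc_le {a : ℕ → ℝ} (ha : ∀ q, 0 ≤ a q) {s : ℝ}
    (hs : ∀ N, ∑ q ∈ Finset.range N, a q ≤ s) (c N : ℕ) :
    ∑ p ∈ Finset.range N, ∑ q ∈ Finset.Icc (p - c) (p + c), a q ≤ (2 * c + 1) * s := by
  have h1 : ∑ p ∈ Finset.range N, ∑ q ∈ Finset.Icc (p - c) (p + c), a q =
      ∑ q ∈ Finset.range (N + c), ∑ p ∈ (Finset.range N).filter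
        (fun p => q ∈ Finset.Icc (p - c) (p + c)), a q := by
    refine Finset.sum_comm' fun p q => ?_
    simp only [Finset.mem_range, Finset.mem_Icc, Finset.mem_filter]
    omega
  rw [h1]
  calc _ ≤ ∑ q ∈ Finset.range (N + c), (2 * c + 1) * a q := by
        refine Finset.sum_le_sum fun q _ => ?_
        rw [Finset.sum_const, nsmul_eq_mul]
        refine mul_le_mul_of_nonneg_right ?_ (ha q)
        have hsub : (Finset.range N).filter (fun p => q ∈ Finset.Icc (p - c) (p + c)) ⊆
            Finset.Icc (q - c) (q + c) := by
          intro p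
          simp only [Finset.mem_range, Finset.mem_Icc, Finset.mem_filter]
          omega
        have hcard := Finset.card_le_card hsub
        rw [Nat.card_Icc] at hcard
        exact_mod_cast hcard.trans (by omega)
    _ ≤ _ := by
        rw [← Finset.mul_sum]
        exact mul_le_mul_of_nonneg_left (hs _) (by positivity)

/-- The commutator of a banded operator with a diagonal operator whose eigenvalues have bounded
increments is bounded. -/
theorem IsBanded.hasBoundedCommutator (hV : Monotone V)
    (hP : IsProjectionResolution (incrementProj V)) {β : ℕ → ℝ} {C : ℝ}
    (hβ : ∀ q, |β (q + 1) - β q| ≤ C) {D : H →ₗ.[ℂ] H}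
    (hD : IsDiagonalOperator (incrementProj V) β D) {c : ℕ} {T : H →L[ℂ] H}
    (hT : IsBanded V c T) : HasBoundedCommutator D T := by
  set P := incrementProj V with hPdef
  have hC : 0 ≤ C := (abs_nonneg _).trans (hβ 0)
  let W : ℕ → Finset ℕ := fun p => Finset.Icc (p - c) (p + c)
  -- K p = ∑_q (β_p - β_q) P_p T P_q is the p-th block row of D T - T D; the sum is finite because T
  -- is banded.
  let K : ℕ → H →L[ℂ] H := fun p => P p * T * ∑ q ∈ W p, ((β p - β q : ℝ) : ℂ) • P q
  have hKapp : ∀ p f, K p f = P p (T (∑ q ∈ W p, ((β p - β q : ℝ) : ℂ) • P q f)) := by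
    intro p f
    simp only [K, mul_apply_eq_comp, sum_apply, smul_apply]
  have hexp : ∀ p f, P p (T f) = ∑ q ∈ W p, P p (T (P q f)) := by
    intro p f
    refine (((hP.hasSum f).mapL T).mapL (P p)).unique (hasSum_sum_of_ne_finset_zero fun q hq => ?_)
    exact hT.incrementProj_eq_zero hV hq f
  obtain ⟨S, hS, -⟩ := hP.exists_operator K
    (fun p f => by rw [hKapp, hP.apply_self])
    -- In the window of p the differences of eigenvalues are at most C c; the overlap of the windows
    -- contributes the factor 2c + 1.
    (C := Real.sqrt ((‖T‖ * (C * c)) ^ 2 * (2 * c + 1))) (Real.sqrt_nonneg _) fun f N => by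
      rw [Real.sq_sqrt (by positivity)]
      have h1 : ∀ p, ‖K p f‖ ^ 2 ≤ (‖T‖ * (C * c)) ^ 2 * ∑ q ∈ W p, ‖P q f‖ ^ 2 := by
        intro p
        have h2 := hP.norm_sum_smul_sq_le (W p) (fun q => β p - β q)
          (fun q hq => abs_sub_le_of_mem_Icc hβ hq) f
        have h3 : ‖K p f‖ ≤ ‖T‖ * ‖∑ q ∈ W p, ((β p - β q : ℝ) : ℂ) • P q f‖ := by
          rw [hKapp]
          exact (hP.norm_apply_le p _).trans (T.le_opNorm _)
        calc ‖K p f‖ ^ 2 ≤ (‖T‖ * ‖∑ q ∈ W p, ((β p - β q : ℝ) : ℂ) • P q f‖) ^ 2 :=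
              pow_le_pow_left₀ (norm_nonneg _) h3 2
          _ = ‖T‖ ^ 2 * ‖∑ q ∈ W p, ((β p - β q : ℝ) : ℂ) • P q f‖ ^ 2 := mul_pow _ _ _
          _ ≤ ‖T‖ ^ 2 * ((C * c) ^ 2 * ∑ q ∈ W p, ‖P q f‖ ^ 2) :=
              mul_le_mul_of_nonneg_left h2 (sq_nonneg _)
          _ = _ := by ring
      calc ∑ p ∈ Finset.range N, ‖K p f‖ ^ 2
          ≤ ∑ p ∈ Finset.range N, (‖T‖ * (C * c)) ^ 2 * ∑ q ∈ W p, ‖P q f‖ ^ 2 :=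
            Finset.sum_le_sum fun p _ => h1 p
        _ = (‖T‖ * (C * c)) ^ 2 * ∑ p ∈ Finset.range N, ∑ q ∈ W p, ‖P q f‖ ^ 2 :=
            (Finset.mul_sum _ _ _).symm
        _ ≤ (‖T‖ * (C * c)) ^ 2 * ((2 * c + 1) * ‖f‖ ^ 2) :=
            mul_le_mul_of_nonneg_left (sum_range_sum_Icc_le (fun _ => sq_nonneg _)
              (fun N => sum_le_hasSum _ (fun _ _ => sq_nonneg _) (hP.hasSum_norm_sq f)) c N)
              (sq_nonneg _)
        _ = _ := by ring
  refine ⟨S, fun f => ?_⟩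
  -- The p-th component of T D f + S f is β_p P_p T f, so by maximality of the domain T f lies in it
  -- and D T f = T D f + S f.
  obtain ⟨h1, h2⟩ := (hD (T f) (T (D f) + S f)).2 fun p => by
    rw [map_add, hS, hKapp, hexp p (D f), hexp p f, map_sum, map_sum, ← Finset.sum_add_distrib,
      Finset.smul_sum]
    refine Finset.sum_congr rfl fun q _ => ?_
    rw [IsDiagonalOperator.proj_apply hD, map_smul, map_smul, map_smul, map_smul, ← add_smul]
    congr 1
    push_cast
    ring
  exact ⟨h1, by rw [h2, add_sub_cancel_left]⟩

end Filtration

/-! ### The dense *-subalgebra -/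

/-- The summands are positive, so a vanishing sum forces each to vanish. -/
theorem eq_zero_of_sum_star_mul_self_eq_zero {B ι : Type*} [NonUnitalCStarAlgebra B]
    (s : Finset ι) (x : ι → B) (h : ∑ i ∈ s, star (x i) * x i = 0) : ∀ i ∈ s, x i = 0 := by
  let := CStarAlgebra.spectralOrder B
  have := CStarAlgebra.spectralOrderedRing B
  intro i hi
  have h1 := (Finset.sum_eq_zero_iff_of_nonneg fun i _ => star_mul_self_nonneg (x i)).1 h i hi
  exact CStarRing.star_mul_self_eq_zero_iff _ |>.1 h1

theorem continuous_nonUnitalStarAlgHom {A B : Type*} [NonUnitalCStarAlgebra A]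
    [NonUnitalCStarAlgebra B] (φ : A →⋆ₙₐ[ℂ] B) : Continuous φ :=
  AddMonoidHomClass.continuous_of_bound φ 1 fun a => by
    rw [one_mul]
    exact NonUnitalStarAlgHom.norm_apply_le φ a

namespace KGraph

variable {k : ℕ} {Λ : KGraph.{u} k} [Λ.IsFinite]

namespace CKFamily

variable {B : Type*} [NonUnitalCStarAlgebra B] (T : Λ.CKFamily B)

theorem id_mul (p : Λ.P) : T.t (Λ.id (Λ.r p)) * T.t p = T.t p := by
  rw [T.mul _ _ (Λ.s_id _), Λ.id_comp]

theorem mul_id (p : Λ.P) : T.t p * T.t (Λ.id (Λ.s p)) = T.t p := by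
  rw [T.mul _ _ (Λ.r_id _).symm, Λ.comp_id]

theorem star_id (v : Λ.V) : star (T.t (Λ.id v)) = T.t (Λ.id v) := (T.proj v).2

theorem mul_eq_zero {p q : Λ.P} (h : Λ.s p ≠ Λ.r q) : T.t p * T.t q = 0 := by
  rw [← T.mul_id p, ← T.id_mul q, mul_assoc, ← mul_assoc (T.t (Λ.id _)), T.orthogonal _ _ h,
    zero_mul, mul_zero]

theorem star_mul_eq_zero_of_r_ne {p q : Λ.P} (h : Λ.r p ≠ Λ.r q) :
    star (T.t p) * T.t q = 0 := by
  rw [← T.id_mul p, ← T.id_mul q, star_mul, T.star_id, mul_assoc, ← mul_assoc (T.t (Λ.id _)),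
    T.orthogonal _ _ h, zero_mul, mul_zero]

/-- Compress ∑ t_p t_p^* = t_{r(q)} by t_q on both sides. The term of q alone already gives the
right-hand side, so the remaining positive terms (t_p^* t_q)^* (t_p^* t_q) add up to zero. -/
theorem star_mul_eq_zero {p q : Λ.P} (hd : Λ.deg p = Λ.deg q) (h : p ≠ q) :
    star (T.t p) * T.t q = 0 := by
  classical
  by_cases hr : Λ.r p = Λ.r q
  · have hp : p ∈ (Λ.pathsTo (Λ.r q) (Λ.deg q)).erase q :=
      Finset.mem_erase.2 ⟨h, mem_pathsTo.2 ⟨hr, hd⟩⟩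
    refine eq_zero_of_sum_star_mul_self_eq_zero ((Λ.pathsTo (Λ.r q) (Λ.deg q)).erase q)
      (fun p => star (T.t p) * T.t q) ?_ p hp
    have h1 := congrArg (fun a => star (T.t q) * a * T.t q) (T.sum_mul_star (Λ.r q) (Λ.deg q))
    simp only [Finset.mul_sum, Finset.sum_mul] at h1
    rw [← Finset.add_sum_erase _ _ (mem_pathsTo.2 ⟨rfl, rfl⟩ : q ∈ Λ.pathsTo _ _)] at h1
    have h2 : star (T.t q) * (T.t q * star (T.t q)) * T.t q =
        star (T.t q) * T.t (Λ.id (Λ.r q)) * T.t q := by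
      rw [mul_assoc (star (T.t q)) (T.t (Λ.id _)), T.id_mul, mul_assoc, T.partial_isometry]
    rw [h2] at h1
    have h3 := add_eq_left.1 h1
    refine Eq.trans (Finset.sum_congr rfl fun i _ => ?_) h3
    rw [star_mul, star_star]
    simp only [mul_assoc]
  · exact T.star_mul_eq_zero_of_r_ne hr

theorem star_mul_comp {p q : Λ.P} (h : Λ.s p = Λ.r q) :
    star (T.t p) * T.t (Λ.comp p q) = T.t q := by
  rw [← T.mul p q h, ← mul_assoc, T.star_mul_self, h, T.id_mul]

theorem star_mul_of_head_ne {p q : Λ.P} (hd : Λ.deg p ≤ Λ.deg q) (h : head q (Λ.deg p) ≠ p) :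
    star (T.t p) * T.t q = 0 := by
  rw [← head_comp_tail hd, ← T.mul _ _ (s_head hd), ← mul_assoc,
    T.star_mul_eq_zero (deg_head hd).symm h.symm, zero_mul]

/-- A product `t_p^* t_q` with `d(p) ≤ d(q)` is zero or one of the generators. -/
theorem star_mul_eq_zero_or {p q : Λ.P} (hd : Λ.deg p ≤ Λ.deg q) :
    star (T.t p) * T.t q = 0 ∨ ∃ e, star (T.t p) * T.t q = T.t e := by
  by_cases h : head q (Λ.deg p) = p
  · right
    refine ⟨tail q (Λ.deg p), ?_⟩
    have h1 := T.star_mul_comp (s_head hd)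
    rwa [head_comp_tail hd, h] at h1
  · exact Or.inl (T.star_mul_of_head_ne hd h)

/-- The linear span of the elements `t_p t_q^*`. -/
def span : Submodule ℂ B := Submodule.span ℂ {a | ∃ p q : Λ.P, a = T.t p * star (T.t q)}

theorem mul_star_mem_span (p q : Λ.P) : T.t p * star (T.t q) ∈ T.span :=
  Submodule.subset_span ⟨p, q, rfl⟩

theorem mem_span (p : Λ.P) : T.t p ∈ T.span := by
  have h := T.mul_star_mem_span p (Λ.id (Λ.s p))
  rwa [T.star_id, T.mul_id] at h

theorem star_mem_span {a : B} (ha : a ∈ T.span) : star a ∈ T.span := by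
  induction ha using Submodule.span_induction with
  | mem a h =>
    obtain ⟨p, q, rfl⟩ := h
    rw [star_mul, star_star]
    exact T.mul_star_mem_span q p
  | zero => rw [star_zero]; exact zero_mem _
  | add a b _ _ ha hb => rw [star_add]; exact add_mem ha hb
  | smul c a _ ha => rw [star_smul]; exact Submodule.smul_mem _ _ ha

/-- If left multiplication by `b` maps the spanning elements into the span, then it preserves the
span. -/
theorem mul_mem_span_of {b : B} (hb : ∀ p q, b * (T.t p * star (T.t q)) ∈ T.span) {a : B}
    (ha : a ∈ T.span) : b * a ∈ T.span := by
  induction ha using Submodule.span_induction with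
  | mem a h =>
    obtain ⟨p, q, rfl⟩ := h
    exact hb p q
  | zero => rw [mul_zero]; exact zero_mem _
  | add a b _ _ ha hb => rw [mul_add]; exact add_mem ha hb
  | smul c a _ ha => rw [mul_smul_comm]; exact Submodule.smul_mem _ _ ha

theorem t_mul_mem_span (p : Λ.P) {a : B} (ha : a ∈ T.span) : T.t p * a ∈ T.span := by
  refine T.mul_mem_span_of (fun q e => ?_) ha
  rw [← mul_assoc]
  by_cases h : Λ.s p = Λ.r q
  · rw [T.mul _ _ h]
    exact T.mul_star_mem_span _ _
  · rw [T.mul_eq_zero h, zero_mul]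
    exact zero_mem _

theorem mul_star_t_mem_span (p : Λ.P) {a : B} (ha : a ∈ T.span) : a * star (T.t p) ∈ T.span := by
  have h := T.star_mem_span (T.t_mul_mem_span p (T.star_mem_span ha))
  rwa [star_mul, star_star] at h

/-- Insert t_{r(q)} = ∑ t_e t_e^* over the e of degree d(p) ∨ d(q). Each e is long enough for t_p^*
t_e and t_q^* t_e to be zero or generators. -/
theorem star_t_mul_t_mem_span (p q : Λ.P) : star (T.t p) * T.t q ∈ T.span := by
  have h1 : star (T.t p) * T.t q = ∑ e ∈ Λ.pathsTo (Λ.r q) (Λ.deg p ⊔ Λ.deg q),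
      (star (T.t p) * T.t e) * star (star (T.t q) * T.t e) := by
    conv_lhs => rw [← T.id_mul q, ← T.sum_mul_star (Λ.r q) (Λ.deg p ⊔ Λ.deg q)]
    rw [Finset.sum_mul, Finset.mul_sum]
    refine Finset.sum_congr rfl fun e _ => ?_
    rw [star_mul, star_star]
    simp only [mul_assoc]
  rw [h1]
  refine Submodule.sum_mem _ fun e he => ?_
  have hd := (mem_pathsTo.1 he).2
  rcases T.star_mul_eq_zero_or (p := p) (q := e) (hd ▸ le_sup_left) with h2 | ⟨a, h2⟩
  · rw [h2, zero_mul]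
    exact zero_mem _
  · rcases T.star_mul_eq_zero_or (p := q) (q := e) (hd ▸ le_sup_right) with h3 | ⟨b, h3⟩
    · rw [h3, star_zero, mul_zero]
      exact zero_mem _
    · rw [h2, h3]
      exact T.mul_star_mem_span a b

theorem mul_mem_span {a b : B} (ha : a ∈ T.span) (hb : b ∈ T.span) : a * b ∈ T.span := by
  induction ha using Submodule.span_induction with
  | mem a h =>
    obtain ⟨p, q, rfl⟩ := h
    rw [mul_assoc]
    refine T.t_mul_mem_span p (T.mul_mem_span_of (fun p' q' => ?_) hb)
    rw [← mul_assoc]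
    exact T.mul_star_t_mem_span q' (T.star_t_mul_t_mem_span q p')
  | zero => rw [zero_mul]; exact zero_mem _
  | add a b _ _ ha hb => rw [add_mul]; exact add_mem ha hb
  | smul c a _ ha => rw [smul_mul_assoc]; exact Submodule.smul_mem _ _ ha

end CKFamily

theorem dense_smoothAlg : Dense (Λ.smoothAlg : Set Λ.CStar) := by
  intro x
  -- C*(Λ) carries the subspace topology of the bounded product, so it suffices that the image of
  -- 𝒜_Λ there contains the *-algebra generated by the s_p.
  rw [closure_subtype]
  refine closure_mono ?_ x.2
  intro y hy
  induction hy using NonUnitalStarAlgebra.adjoin_induction with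
  | mem y h =>
    obtain ⟨p, rfl⟩ := h
    exact ⟨Λ.gen p, Λ.genFamily.mem_span p, rfl⟩
  | zero => exact ⟨0, zero_mem _, rfl⟩
  | add a b _ _ ha hb =>
    obtain ⟨a, ha, rfl⟩ := ha
    obtain ⟨b, hb, rfl⟩ := hb
    exact ⟨a + b, add_mem ha hb, rfl⟩
  | mul a b _ _ ha hb =>
    obtain ⟨a, ha, rfl⟩ := ha
    obtain ⟨b, hb, rfl⟩ := hb
    exact ⟨a * b, Λ.genFamily.mul_mem_span ha hb, rfl⟩
  | smul c a _ ha =>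
    obtain ⟨a, ha, rfl⟩ := ha
    exact ⟨c • a, Submodule.smul_mem _ c ha, rfl⟩
  | star a _ ha =>
    obtain ⟨a, ha, rfl⟩ := ha
    exact ⟨star a, Λ.genFamily.star_mem_span ha, rfl⟩

/-! ### Existence and uniqueness of the representation -/

section PathRep

variable [Λ.HasPathMeasure]

theorem isPathRep_iff {π : Λ.CStar →⋆ₙₐ[ℂ] (Λ.L2 →L[ℂ] Λ.L2)} :
    Λ.IsPathRep π ↔ ∀ p, π (Λ.gen p) = pathOp p := by
  constructor
  · intro h p
    refine clm_ext_chiLp fun q => Lp.ext ?_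
    exact (h p q (chiLp q) (coeFn_chiLp q)).trans (coeFn_pathOp_chiLp p q).symm
  · intro h p q f hf
    rw [h, eq_chiLp_iff.1 hf]
    exact coeFn_pathOp_chiLp p q

theorem existsUnique_isPathRep : ∃! π, Λ.IsPathRep π := by
  obtain ⟨π, hπ⟩ := Λ.exists_lift (Λ.L2 →L[ℂ] Λ.L2) Λ.pathFamily
  refine ⟨π, isPathRep_iff.2 hπ, fun π' hπ' => ?_⟩
  replace hπ' := isPathRep_iff.1 hπ'
  have hc : ∀ φ : Λ.CStar →⋆ₙₐ[ℂ] (Λ.L2 →L[ℂ] Λ.L2), Continuous φ := fun φ =>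
    continuous_nonUnitalStarAlgHom φ
  refine DFunLike.coe_injective (Continuous.ext_on (dense_smoothAlg (Λ := Λ)) (hc π') (hc π)
    fun a ha => ?_)
  induction ha using Submodule.span_induction with
  | mem a h =>
    obtain ⟨p, q, rfl⟩ := h
    rw [map_mul, map_mul, map_star, map_star, hπ', hπ', hπ, hπ]
    rfl
  | zero => rw [map_zero, map_zero]
  | add a b _ _ ha hb => rw [map_add, map_add, ha, hb]
  | smul c a _ ha => rw [map_smul, map_smul, ha]

end PathRep

end KGraph

/-! ### The Dirac operator -/

namespace KGraph

variable {k : ℕ} {Λ : KGraph.{u} k} [Λ.IsFinite] [Λ.HasPathMeasure]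

theorem cylSpan_eq_span (n : ℕ) :
    Λ.cylSpan n = Submodule.span ℂ (chiLp '' {p : Λ.P | Λ.deg p ≤ diag k n}) := by
  rw [cylSpan]
  congr 1
  ext f
  constructor
  · rintro ⟨p, hp, hf⟩
    exact ⟨p, hp, (eq_chiLp_iff.1 hf).symm⟩
  · rintro ⟨p, hp, rfl⟩
    exact ⟨p, hp, coeFn_chiLp p⟩

theorem chiLp_mem_cylSpan {p : Λ.P} {n : ℕ} (h : Λ.deg p ≤ diag k n) : chiLp p ∈ Λ.cylSpan n := by
  rw [cylSpan_eq_span]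
  exact Submodule.subset_span ⟨p, h, rfl⟩

theorem cylSpan_mono {m n : ℕ} (h : m ≤ n) : Λ.cylSpan m ≤ Λ.cylSpan n := by
  rw [cylSpan_eq_span, cylSpan_eq_span]
  exact Submodule.span_mono (Set.image_mono fun p hp => le_trans hp (diag_mono h))

/-- Splitting [p] into the cylinders of its extensions of degree (n, …, n) provides spanning
functions from which a short path can be stripped. -/
theorem cylSpan_le_span_diag (n : ℕ) :
    Λ.cylSpan n ≤ Submodule.span ℂ (chiLp '' {p : Λ.P | Λ.deg p = diag k n}) := by
  rw [cylSpan_eq_span, Submodule.span_le]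
  rintro _ ⟨p, hp, rfl⟩
  rw [chiLp_eq_sum p (diag k n - Λ.deg p)]
  exact Submodule.sum_mem _ fun q hq => Submodule.subset_span ⟨_, deg_comp_diag hp hq, rfl⟩

theorem constSpan_le_cylSpan_zero : Λ.constSpan ≤ Λ.cylSpan 0 := by
  rw [constSpan, Submodule.span_le]
  intro f hf
  have h : f = ∑ v ∈ (Finset.univ : Finset Λ.V), chiLp (Λ.id v) := by
    refine Lp.ext ?_
    have h1 : ∀ᵐ x ∂Λ.pathMeasure, ∀ v ∈ (Finset.univ : Finset Λ.V),
        chiLp (Λ.id v) x = Λ.chi (Λ.id v) x :=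
      (Finset.eventually_all _).2 fun v _ => coeFn_chiLp _
    filter_upwards [hf, h1, Lp.coeFn_finsetSum (Finset.univ : Finset Λ.V)
      fun v => (chiLp (Λ.id v) : Λ.L2)] with x h1 h2 h3
    rw [h1, h3, Finset.sum_apply, Finset.sum_congr rfl h2]
    have h4 := Finset.indicator_biUnion_apply (Finset.univ : Finset Λ.V)
      (fun v => Λ.cylinder (Λ.id v)) (f := fun _ => (1 : ℂ)) (fun v _ w _ hvw =>
        disjoint_cylinder_of_r_ne (by rwa [Λ.r_id, Λ.r_id])) x
    rw [← univ_eq_iUnion_cylinder, Set.indicator_univ] at h4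
    exact h4
  rw [h]
  refine Submodule.sum_mem _ fun v _ => chiLp_mem_cylSpan ?_
  rw [Λ.deg_id]
  exact zero_le

theorem monotone_cylSpanPred : Monotone Λ.cylSpanPred := by
  refine monotone_nat_of_le_succ fun n => ?_
  cases n with
  | zero => exact constSpan_le_cylSpan_zero
  | succ n => exact cylSpan_mono n.le_succ

theorem isProjectionResolution_cylSpanPred :
    IsProjectionResolution (incrementProj Λ.cylSpanPred) := by
  refine isProjectionResolution_incrementProj monotone_cylSpanPred ?_
  rw [← Submodule.dense_iff_topologicalClosure_eq_top]
  refine dense_span_of_chiLp_mem fun p => Submodule.le_topologicalClosure _ ?_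
  exact le_iSup Λ.cylSpanPred (∑ i, Λ.deg p i + 1) (chiLp_mem_cylSpan (le_diag_sum _))

/-- The eigenvalues of the Dirac operator, with the eigenvalue zero on the constants in front. -/
def diracEigenvalue (α : ℕ → ℝ) : ℕ → ℝ
  | 0 => 0
  | q + 1 => α q

/-- The indices are shifted by one: Ξ_q - Ξ_{q-1} is the increment number q + 1, and increment 0
projects onto the constants, which D annihilates. Conversely, if P_q y = β_q P_q f for all q, then
P_0 y = 0 and the series defining D f is the expansion of y. -/
theorem isDiagonalOperator_dirac (α : ℕ → ℝ) :
    IsDiagonalOperator (incrementProj Λ.cylSpanPred) (diracEigenvalue α) (Λ.dirac α) := by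
  have hP := isProjectionResolution_cylSpanPred (Λ := Λ)
  have hxi : ∀ q, Λ.xiDiff q = incrementProj Λ.cylSpanPred (q + 1) := fun _ => rfl
  intro f y
  constructor
  · rintro ⟨h, rfl⟩ q
    have hs : Summable fun q => (α q : ℂ) • Λ.xiDiff q f := h
    change incrementProj Λ.cylSpanPred q (∑' i, (α i : ℂ) • Λ.xiDiff i f) = _
    rw [ContinuousLinearMap.map_tsum _ hs]
    simp only [hxi, map_smul]
    cases q with
    | zero =>
      simp only [hP.apply_of_ne 0 _ (Nat.succ_ne_zero _).symm, smul_zero, tsum_zero,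
        diracEigenvalue, Complex.ofReal_zero, zero_smul]
    | succ q =>
      rw [tsum_eq_single q fun i hi => by
        rw [hP.apply_of_ne _ _ (fun e => hi (Nat.succ_injective e).symm), smul_zero],
        hP.apply_self]
      rfl
  · intro h
    have h0 : incrementProj Λ.cylSpanPred 0 y = 0 := by
      rw [h 0, diracEigenvalue, Complex.ofReal_zero, zero_smul]
    have h1 := (hasSum_nat_add_iff' 1).2 (hP.hasSum y)
    rw [Finset.sum_range_one, h0, sub_zero] at h1
    have h2 : (fun q => incrementProj Λ.cylSpanPred (q + 1) y) =
        fun q => (α q : ℂ) • Λ.xiDiff q f := funext fun q => h (q + 1)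
    rw [h2] at h1
    exact ⟨h1.summable, h1.tsum_eq⟩

theorem pathOp_mem_cylSpan (p : Λ.P) {n : ℕ} {f : Λ.L2} (hf : f ∈ Λ.cylSpan n) :
    pathOp p f ∈ Λ.cylSpan (n + ∑ i, Λ.deg p i) := by
  rw [cylSpan_eq_span] at hf
  induction hf using Submodule.span_induction with
  | mem f h =>
    obtain ⟨q, hq, rfl⟩ := h
    by_cases h : Λ.s p = Λ.r q
    · rw [pathOp_chiLp h]
      refine Submodule.smul_mem _ _ (chiLp_mem_cylSpan ?_)
      rw [Λ.deg_comp _ _ h, add_comm]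
      exact add_le_add hq (le_diag_sum _)
    · rw [pathOp_chiLp_of_ne h]
      exact zero_mem _
  | zero => rw [map_zero]; exact zero_mem _
  | add f g _ _ hf hg => rw [map_add]; exact add_mem hf hg
  | smul c f _ hf => rw [map_smul]; exact Submodule.smul_mem _ _ hf

theorem adjoint_pathOp_mem_cylSpan (p : Λ.P) {n : ℕ} {f : Λ.L2} (hf : f ∈ Λ.cylSpan n) :
    ContinuousLinearMap.adjoint (pathOp p) f ∈ Λ.cylSpan (n + ∑ i, Λ.deg p i) := by
  -- At level n + ∑ d(p)_i, f is a combination of χ_[q] with d(q) diagonal and d(p) ≤ d(q);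
  -- stripping p does not raise the degree.
  replace hf := cylSpan_le_span_diag _ (cylSpan_mono (Nat.le_add_right n (∑ i, Λ.deg p i)) hf)
  induction hf using Submodule.span_induction with
  | mem f h =>
    obtain ⟨q, hq, rfl⟩ := h
    have hq' : Λ.deg q = diag k (n + ∑ i, Λ.deg p i) := hq
    have hd : Λ.deg p ≤ Λ.deg q := by
      rw [hq']
      exact (le_diag_sum _).trans (diag_mono (Nat.le_add_left _ _))
    by_cases h : head q (Λ.deg p) = p
    · have h1 : Λ.s p = Λ.r (tail q (Λ.deg p)) := by
        rw [← s_head hd, h]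
      have h2 : chiLp q = chiLp (Λ.comp p (tail q (Λ.deg p))) := by
        conv_lhs => rw [← head_comp_tail hd, h]
      rw [h2, adjoint_pathOp_chiLp h1]
      refine Submodule.smul_mem _ _ (chiLp_mem_cylSpan ?_)
      rw [deg_tail hd, hq']
      exact tsub_le_self
    · rw [adjoint_pathOp_chiLp_of_ne hd h]
      exact zero_mem _
  | zero => rw [map_zero]; exact zero_mem _
  | add f g _ _ hf hg => rw [map_add]; exact add_mem hf hg
  | smul c f _ hf => rw [map_smul]; exact Submodule.smul_mem _ _ hf

theorem isBanded_pathOp (p : Λ.P) :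
    IsBanded Λ.cylSpanPred (∑ i, Λ.deg p i + 1) (pathOp p) := fun q f hf => by
  -- Level q of the filtration is R_{q-1}. Passing to R_q puts the constants among the cylinder
  -- functions and accounts for the extra 1 in the band width.
  have h : f ∈ Λ.cylSpan q := monotone_cylSpanPred q.le_succ hf
  exact ⟨pathOp_mem_cylSpan p h, adjoint_pathOp_mem_cylSpan p h⟩

theorem exists_isBanded {π : Λ.CStar →⋆ₙₐ[ℂ] (Λ.L2 →L[ℂ] Λ.L2)} (hπ : Λ.IsPathRep π)
    {a : Λ.CStar} (ha : a ∈ Λ.smoothAlg) : ∃ c, IsBanded Λ.cylSpanPred c (π a) := by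
  rw [isPathRep_iff] at hπ
  induction ha using Submodule.span_induction with
  | mem a h =>
    obtain ⟨p, q, rfl⟩ := h
    rw [map_mul, map_star, hπ, hπ]
    exact ⟨_, (isBanded_pathOp p).mul (isBanded_pathOp q).star⟩
  | zero => rw [map_zero]; exact ⟨0, IsBanded.zero 0⟩
  | add a b _ _ ha hb =>
    obtain ⟨c, hc⟩ := ha
    obtain ⟨d, hd⟩ := hb
    rw [map_add]
    exact ⟨max c d, (hc.mono monotone_cylSpanPred (le_max_left c d)).add
      (hd.mono monotone_cylSpanPred (le_max_right c d))⟩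
  | smul z a _ ha =>
    obtain ⟨c, hc⟩ := ha
    rw [map_smul]
    exact ⟨c, hc.smul z⟩

theorem hasBoundedCommutator_dirac {π : Λ.CStar →⋆ₙₐ[ℂ] (Λ.L2 →L[ℂ] Λ.L2)}
    (hπ : Λ.IsPathRep π) {α : ℕ → ℝ} {C : ℝ} (hα : ∀ q, |α (q + 1) - α q| ≤ C) {a : Λ.CStar}
    (ha : a ∈ Λ.smoothAlg) : HasBoundedCommutator (Λ.dirac α) (π a) := by
  obtain ⟨c, hc⟩ := exists_isBanded hπ ha
  -- The eigenvalue sequence is 0, α_0, α_1, …, so its first increment is α_0, which C need not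
  -- bound.
  refine hc.hasBoundedCommutator (C := max C |α 0|) monotone_cylSpanPred
    isProjectionResolution_cylSpanPred (fun q => ?_) (isDiagonalOperator_dirac α)
  cases q with
  | zero =>
    change |α 0 - 0| ≤ _
    rw [sub_zero]
    exact le_max_right _ _
  | succ q => exact (hα q).trans (le_max_left _ _)

theorem isSpectralTriple_dirac {π : Λ.CStar →⋆ₙₐ[ℂ] (Λ.L2 →L[ℂ] Λ.L2)}
    (hπ : Λ.IsPathRep π) {α : ℕ → ℝ} (hlim : Tendsto α atTop atTop) {C : ℝ}
    (hα : ∀ q, |α (q + 1) - α q| ≤ C) : IsSpectralTriple Λ.smoothAlg π (Λ.dirac α) where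
  mul_mem _ ha _ hb := Λ.genFamily.mul_mem_span ha hb
  star_mem _ ha := Λ.genFamily.star_mem_span ha
  dense := dense_smoothAlg
  dense_domain := (isDiagonalOperator_dirac α).dense_domain isProjectionResolution_cylSpanPred
  self_adjoint := (isDiagonalOperator_dirac α).isSelfAdjoint isProjectionResolution_cylSpanPred
  compact_resolvent := (isDiagonalOperator_dirac α).hasCompactResolvent
    isProjectionResolution_cylSpanPred isCompactOperator_incrementProj
    ((tendsto_add_atTop_iff_nat 1).1 hlim)
  bounded_commutator _ ha := hasBoundedCommutator_dirac hπ hα ha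

end KGraph

end

/-! ### The main theorem -/

theorem mainTheorem5 {k : ℕ} (Λ : KGraph.{u} k) [Nonempty Λ.V] [Λ.IsFinite]
    (hconn : Λ.StronglyConnected) (hsrc : Λ.NoSources) :
    (∃! x, Λ.IsPerronFrobenius x) ∧ (∃! μ, Λ.IsPathMeasure μ) ∧ (∃! π, Λ.IsPathRep π) ∧
      ∀ π, Λ.IsPathRep π → ∀ α : ℕ → ℝ, (∀ q, 0 < α q) → Monotone α → Tendsto α atTop atTop →
        (∃ C : ℝ, 0 ≤ C ∧ ∀ q, |α (q + 1) - α q| ≤ C) →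
          (∀ a ∈ Λ.smoothAlg, HasBoundedCommutator (Λ.dirac α) (π a)) ∧
            IsSpectralTriple Λ.smoothAlg π (Λ.dirac α) := by
  have := KGraph.hasPathMeasure hconn hsrc
  refine ⟨KGraph.existsUnique_perronFrobenius hconn, KGraph.existsUnique_isPathMeasure hconn hsrc,
    KGraph.existsUnique_isPathRep, ?_⟩
  rintro π hπ α - - hlim ⟨C, -, hα⟩
  exact ⟨fun a ha => KGraph.hasBoundedCommutator_dirac hπ hα ha,
    KGraph.isSpectralTriple_dirac hπ hlim hα⟩
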